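/- Let $\mathcal L_{\mathbb N}$ be the first-order language with equality and signature $\{0,\mathrm S,+,\times\}$, and let $\mathcal L_T=\mathcal L_{\mathbb N}\cup\{T\}$ with $T$ a unary predicate. Formulas are built from the atoms $s=t$ and $Tt$ and the constants $\top,\bot$ by $\neg,\wedge,\forall$; free and bound variables are kept distinct, and formulas that differ only in the names of bound variables are identified. The logical complexity is $|\varphi|=0$ for atoms and $\top,\bot$, $|\neg\varphi|=|\forall x\varphi|=|\varphi|+1$, and $|\varphi\wedge\psi|=\max(|\varphi|,|\psi|)+1$. Fix a standard (injective) Gödel numbering $\#$ of $\mathcal L_T$, and let $\bar l$ be the numeral of $l$. Sequents $\Gamma\Rightarrow\Delta$ consist of finite multisets of formulas. The system $\mathrm{LPT}_{\mathbb N}$ has the following initial sequents and rules, in which $r,s,t$ are arbitrary terms (there are no rules for $\top$ and $\bot$): * initial sequents $\Gamma,s=t\Rightarrow s=t,\Delta$ and $\Gamma,\mathrm S s=0\Rightarrow\Delta$; * cut: from $\Gamma\Rightarrow\Delta,\varphi$ and $\varphi,\Gamma\Rightarrow\Delta$ infer $\Gamma\Rightarrow\Delta$; * negation: from $\Gamma\Rightarrow\varphi,\Delta$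 infer $\Gamma,\neg\varphi\Rightarrow\Delta$; from $\Gamma,\varphi\Rightarrow\Delta$ infer $\Gamma\Rightarrow\neg\varphi,\Delta$; * conjunction: from $\Gamma,\varphi,\psi\Rightarrow\Delta$ infer $\Gamma,\varphi\wedge\psi\Rightarrow\Delta$; from $\Gamma\Rightarrow\varphi,\Delta$ and $\Gamma\Rightarrow\psi,\Delta$ infer $\Gamma\Rightarrow\varphi\wedge\psi,\Delta$; * quantifier: from $\Gamma,\forall x\varphi,\varphi(s/x)\Rightarrow\Delta$ infer $\Gamma,\forall x\varphi\Rightarrow\Delta$; from $\Gamma\Rightarrow\varphi(y/x),\Delta$ infer $\Gamma\Rightarrow\forall x\varphi,\Delta$ if the variable $y$ is not free in $\Gamma,\Delta,\forall x\varphi$; * equality: from $\Gamma,t=t\Rightarrow\Delta$ infer $\Gamma\Rightarrow\Delta$; from $s=t,\varphi(s),\varphi(t),\Gamma\Rightarrow\Delta$ infer $s=t,\varphi(t),\Gamma\Rightarrow\Delta$, for $\varphi(v)$ an atomic formula of $\mathcal L_{\mathbb N}$; * arithmetic: from $\Gamma,s=t,\mathrm Ss=\mathrm St\Rightarrow\Delta$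 infer $\Gamma,\mathrm Ss=\mathrm St\Rightarrow\Delta$; from $\Gamma,s=0\Rightarrow\Delta$ and $\Gamma,s=\mathrm S y\Rightarrow\Delta$ infer $\Gamma\Rightarrow\Delta$ if the variable $y$ is not free in $\Gamma,\Delta,s$; from $\Gamma,e\Rightarrow\Delta$ infer $\Gamma\Rightarrow\Delta$, where $e$ is one of $s+0=s$, $s+\mathrm St=\mathrm S(s+t)$, $s\times0=0$, $s\times\mathrm St=(s\times t)+s$; * truth: from $\Gamma\Rightarrow\varphi,\Delta$ infer $\Gamma\Rightarrow T\bar l,\Delta$, and from $\Gamma,\varphi\Rightarrow\Delta$ infer $\Gamma,T\bar l\Rightarrow\Delta$, where $\varphi$ is a sentence of $\mathcal L_T$ and $l=\#\varphi$. The length of a derivation is the height of its tree (initial sequents have length $0$). The rank of a cut on $\varphi$ is $|\varphi|+1$, and the cut rank of a derivation is the maximum of the ranks of its cuts ($0$ if there are none). The $T$-complexity $\tau$ of formula occurrences in a derivation is defined thus: it is $0$ for all occurrences in initial sequents and for all formulas of $\mathcal L_{\mathbb N}$; the principal formula of a truth rule gets $\tau(T\bar l)=\tau(\varphi)+1$;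 the principal formula of a logical rule gets the maximum of the values of its active formulas in the premisses; side formulas keep their value, where in rules with two premisses the maximum of the two corresponding values is taken. The $T$-complexity of a derivation is the maximum over all occurrences in it. Write $\vdash^{n}_{m,k}\Gamma\Rightarrow\Delta$ if $\Gamma\Rightarrow\Delta$ has a derivation in $\mathrm{LPT}_{\mathbb N}$ of length $\le n$, cut rank $\le m$ and $T$-complexity $\le k$. Let $2^n_0=n$ and $2^n_{m+1}=2^{2^n_m}$. **Claim.** Cut is eliminable in $\mathrm{LPT}_{\mathbb N}$, with a hyperexponential bound on the length and without increase of $T$-complexity: there is a constant $C$ such that for all $n,m,k,\Gamma,\Delta$, if $\vdash^{n}_{m,k}\Gamma\Rightarrow\Delta$, then $$\vdash^{\,C\cdot 2^{n}_{n}}_{0,k}\Gamma\Rightarrow\Delta,$$ and if moreover $k=0$ (no truth rule is used), then also $\vdash^{\,C\cdot 2^{n}_{m}}_{0,0}\Gamma\Rightarrow\Delta$. -/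

import Mathlib

namespace LPTN

/-- Terms of the language of arithmetic `{0, S, +, ×}` in the scope of `n` quantifiers. Free variables
(`fv`) and bound variables (`bv`) are kept apart; the bound variable `bv i` refers to the `i`-th of
the `n` enclosing quantifiers, counted from the outside. `Tm 0` is the type of ordinary terms. -/
inductive Tm (n : ℕ) : Type
  | fv : ℕ → Tm n
  | bv : Fin n → Tm n
  | zero : Tm n
  | succ : Tm n → Tm n
  | add : Tm n → Tm n → Tm n
  | mul : Tm n → Tm n → Tm n

namespace Tm

/-- An ordinary term, read in the scope of `n` quantifiers. -/
def lift {n : ℕ} : Tm 0 → Tm n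
  | fv x => fv x
  | bv i => i.elim0
  | zero => zero
  | succ t => succ (lift t)
  | add s t => add (lift s) (lift t)
  | mul s t => mul (lift s) (lift t)

/-- `inst s t` is the result of replacing the variable of the outermost quantifier in `t` by `s`. -/
def inst {n : ℕ} (s : Tm 0) : Tm (n + 1) → Tm n
  | fv x => fv x
  | bv i => Fin.cases (motive := fun _ => Tm n) (lift s) (fun j => bv j) i
  | zero => zero
  | succ t => succ (inst s t)
  | add t u => add (inst s t) (inst s u)
  | mul t u => mul (inst s t) (inst s u)

/-- The free variables of a term. -/
def FV {n : ℕ} : Tm n → Finset ℕ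
  | fv x => {x}
  | bv _ => ∅
  | zero => ∅
  | succ t => FV t
  | add s t => FV s ∪ FV t
  | mul s t => FV s ∪ FV t

/-- The numeral of a natural number. -/
def numeral {n : ℕ} : ℕ → Tm n
  | 0 => zero
  | l + 1 => succ (numeral l)

/-- The Gödel number of a term. -/
def code {n : ℕ} : Tm n → ℕ
  | fv x => Nat.pair 0 x
  | bv i => Nat.pair 1 i
  | zero => Nat.pair 2 0
  | succ t => Nat.pair 3 (code t)
  | add s t => Nat.pair 4 (Nat.pair (code s) (code t))
  | mul s t => Nat.pair 5 (Nat.pair (code s) (code t))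

theorem code_injective {n : ℕ} : Function.Injective (code (n := n)) := by
  intro s
  induction s with
  | fv x => intro t h; cases t <;> simp_all [code, Nat.pair_eq_pair]
  | bv x => intro t h; cases t <;> simp_all [code, Nat.pair_eq_pair, Fin.ext_iff]
  | zero => intro t h; cases t <;> simp_all [code, Nat.pair_eq_pair]
  | succ s ih =>
    intro t h
    cases t <;> simp [code, Nat.pair_eq_pair] at h
    rw [ih h]
  | add s s' ih ih' =>
    intro t h
    cases t <;> simp [code, Nat.pair_eq_pair] at h
    rw [ih h.1, ih' h.2]
  | mul s s' ih ih' =>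
    intro t h
    cases t <;> simp [code, Nat.pair_eq_pair] at h
    rw [ih h.1, ih' h.2]

end Tm

/-- Formulas of the language of arithmetic with the truth predicate, in the scope of `n` quantifiers.
`Fml 0` is the type of ordinary formulas. -/
inductive Fml : ℕ → Type
  | bot {n : ℕ} : Fml n
  | top {n : ℕ} : Fml n
  | eq {n : ℕ} : Tm n → Tm n → Fml n
  | tr {n : ℕ} : Tm n → Fml n
  | neg {n : ℕ} : Fml n → Fml n
  | and {n : ℕ} : Fml n → Fml n → Fml n
  | all {n : ℕ} : Fml (n + 1) → Fml n

namespace Fml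

/-- `inst s φ` is the result of replacing the variable of the outermost quantifier in `φ` by `s`:
if `all φ` is the formula `∀x φ`, then `inst s φ` is `φ(s/x)`. -/
def inst (s : Tm 0) : {n : ℕ} → Fml (n + 1) → Fml n
  | _, bot => bot
  | _, top => top
  | _, eq t u => eq (Tm.inst s t) (Tm.inst s u)
  | _, tr t => tr (Tm.inst s t)
  | _, neg φ => neg (inst s φ)
  | _, and φ ψ => and (inst s φ) (inst s ψ)
  | _, all φ => all (inst s φ)

/-- The free variables of a formula. -/
def FV : {n : ℕ} → Fml n → Finset ℕ
  | _, bot => ∅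
  | _, top => ∅
  | _, eq s t => s.FV ∪ t.FV
  | _, tr t => t.FV
  | _, neg φ => FV φ
  | _, and φ ψ => FV φ ∪ FV ψ
  | _, all φ => FV φ

/-- A sentence is a formula without free variables. -/
def IsSentence (φ : Fml 0) : Prop := φ.FV = ∅

/-- The logical complexity of a formula. -/
def complexity : {n : ℕ} → Fml n → ℕ
  | _, bot => 0
  | _, top => 0
  | _, eq _ _ => 0
  | _, tr _ => 0
  | _, neg φ => complexity φ + 1
  | _, and φ ψ => max (complexity φ) (complexity ψ) + 1
  | _, all φ => complexity φ + 1

/-- The Gödel number of a formula. -/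
def code : {n : ℕ} → Fml n → ℕ
  | _, bot => Nat.pair 6 0
  | _, top => Nat.pair 7 0
  | _, eq s t => Nat.pair 8 (Nat.pair s.code t.code)
  | _, tr t => Nat.pair 9 t.code
  | _, neg φ => Nat.pair 10 (code φ)
  | _, and φ ψ => Nat.pair 11 (Nat.pair (code φ) (code ψ))
  | _, all φ => Nat.pair 12 (code φ)

theorem code_injective {n : ℕ} : Function.Injective (code (n := n)) := by
  intro φ
  induction φ with
  | bot => intro ψ h; cases ψ <;> simp_all [code, Nat.pair_eq_pair]
  | top => intro ψ h; cases ψ <;> simp_all [code, Nat.pair_eq_pair]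
  | eq s t =>
    intro ψ h
    cases ψ <;> simp [code, Nat.pair_eq_pair] at h
    rw [Tm.code_injective h.1, Tm.code_injective h.2]
  | tr t =>
    intro ψ h
    cases ψ <;> simp [code, Nat.pair_eq_pair] at h
    rw [Tm.code_injective h]
  | neg φ ih =>
    intro ψ h
    cases ψ <;> simp [code, Nat.pair_eq_pair] at h
    rw [ih h]
  | and φ φ' ih ih' =>
    intro ψ h
    cases ψ <;> simp [code, Nat.pair_eq_pair] at h
    rw [ih h.1, ih' h.2]
  | all φ ih =>
    intro ψ h
    cases ψ <;> simp [code, Nat.pair_eq_pair] at h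
    rw [ih h]

end Fml

/-- The truth ascription `T l̄`, where `l` is the Gödel number of `φ`. -/
def truthOf (φ : Fml 0) : Fml 0 := Fml.tr (Tm.numeral φ.code)

/-- A finite multiset of formula occurrences, each with its truth complexity in the derivation. -/
abbrev Ctx : Type := Multiset (Fml 0 × ℕ)

/-- A context shared by the two premisses of a rule: each occurrence in the conclusion comes with its
truth complexity in the left and in the right premiss. -/
abbrev Ctx2 : Type := Multiset (Fml 0 × ℕ × ℕ)

/-- The context in the left premiss. -/
def Ctx2.left (Γ : Ctx2) : Ctx := Γ.map fun a => (a.1, a.2.1)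

/-- The context in the right premiss. -/
def Ctx2.right (Γ : Ctx2) : Ctx := Γ.map fun a => (a.1, a.2.2)

/-- The context in the conclusion: the truth complexity of an occurrence is the maximum of the truth
complexities of the corresponding occurrences in the premisses. -/
def Ctx2.join (Γ : Ctx2) : Ctx := Γ.map fun a => (a.1, max a.2.1 a.2.2)

/-- The underlying multiset of formulas. -/
def Ctx.forget (Γ : Ctx) : Multiset (Fml 0) := Γ.map Prod.fst

/-- The variable `y` is not free in any formula of the context. -/
def Ctx.Fresh (y : ℕ) (Γ : Ctx) : Prop := ∀ a ∈ Γ, y ∉ a.1.FV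

open Tm Fml in
/-- `Der m k n Γ Δ`: the sequent `Γ ⇒ Δ`, with the truth complexities attached to its formula
occurrences, has a derivation of length at most `n` and cut rank at most `m` in which all truth
complexities are at most `k`. The metavariables `s`, `t` in the arithmetical rules stand for
arbitrary terms. Truth complexities increase at the truth rules only, so that the bound `k` has to be
imposed only there. -/
inductive Der (m k : ℕ) : ℕ → Ctx → Ctx → Prop
  /-- initial sequents, for atomic formulas of the language of arithmetic -/
  | ref (n : ℕ) (Γ Δ : Multiset (Fml 0)) (s t : Tm 0) :
      Der m k n ((eq s t, 0) ::ₘ Γ.map fun φ => (φ, 0)) ((eq s t, 0) ::ₘ Δ.map fun φ => (φ, 0))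
  | cut {n n₀ n₁ : ℕ} (Γ Δ : Ctx2) (φ : Fml 0) (i j : ℕ) (h₀ : n₀ < n) (h₁ : n₁ < n)
      (hm : φ.complexity + 1 ≤ m)
      (d₀ : Der m k n₀ Γ.left ((φ, i) ::ₘ Δ.left))
      (d₁ : Der m k n₁ ((φ, j) ::ₘ Γ.right) Δ.right) :
      Der m k n Γ.join Δ.join
  | negL {n n₀ : ℕ} (Γ Δ : Ctx) (φ : Fml 0) (i : ℕ) (h₀ : n₀ < n)
      (d : Der m k n₀ Γ ((φ, i) ::ₘ Δ)) :
      Der m k n ((neg φ, i) ::ₘ Γ) Δ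
  | negR {n n₀ : ℕ} (Γ Δ : Ctx) (φ : Fml 0) (i : ℕ) (h₀ : n₀ < n)
      (d : Der m k n₀ ((φ, i) ::ₘ Γ) Δ) :
      Der m k n Γ ((neg φ, i) ::ₘ Δ)
  | andL {n n₀ : ℕ} (Γ Δ : Ctx) (φ ψ : Fml 0) (i j : ℕ) (h₀ : n₀ < n)
      (d : Der m k n₀ ((φ, i) ::ₘ (ψ, j) ::ₘ Γ) Δ) :
      Der m k n ((and φ ψ, max i j) ::ₘ Γ) Δ
  | andR {n n₀ n₁ : ℕ} (Γ Δ : Ctx2) (φ ψ : Fml 0) (i j : ℕ) (h₀ : n₀ < n) (h₁ : n₁ < n)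
      (d₀ : Der m k n₀ Γ.left ((φ, i) ::ₘ Δ.left))
      (d₁ : Der m k n₁ Γ.right ((ψ, j) ::ₘ Δ.right)) :
      Der m k n Γ.join ((and φ ψ, max i j) ::ₘ Δ.join)
  | allL {n n₀ : ℕ} (Γ Δ : Ctx) (φ : Fml 1) (s : Tm 0) (i j : ℕ) (h₀ : n₀ < n)
      (d : Der m k n₀ ((all φ, i) ::ₘ (φ.inst s, j) ::ₘ Γ) Δ) :
      Der m k n ((all φ, max i j) ::ₘ Γ) Δ
  | allR {n n₀ : ℕ} (Γ Δ : Ctx) (φ : Fml 1) (y : ℕ) (i : ℕ) (h₀ : n₀ < n)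
      (hΓ : Γ.Fresh y) (hΔ : Δ.Fresh y) (hφ : y ∉ (all φ).FV)
      (d : Der m k n₀ Γ ((φ.inst (fv y), i) ::ₘ Δ)) :
      Der m k n Γ ((all φ, i) ::ₘ Δ)
  | eq1 {n n₀ : ℕ} (Γ Δ : Ctx) (t : Tm 0) (h₀ : n₀ < n)
      (d : Der m k n₀ ((eq t t, 0) ::ₘ Γ) Δ) :
      Der m k n Γ Δ
  /-- replacement in the equation `φ(v)`, which is `a = b` with `v` the variable `bv 0` -/
  | eq2 {n n₀ : ℕ} (Γ Δ : Ctx) (s t : Tm 0) (a b : Tm 1) (h₀ : n₀ < n)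
      (d : Der m k n₀
        ((eq s t, 0) ::ₘ (eq (Tm.inst s a) (Tm.inst s b), 0) ::ₘ
          (eq (Tm.inst t a) (Tm.inst t b), 0) ::ₘ Γ) Δ) :
      Der m k n ((eq s t, 0) ::ₘ (eq (Tm.inst t a) (Tm.inst t b), 0) ::ₘ Γ) Δ
  | q1 (n : ℕ) (Γ Δ : Multiset (Fml 0)) (s : Tm 0) :
      Der m k n ((eq (succ s) zero, 0) ::ₘ Γ.map fun φ => (φ, 0)) (Δ.map fun φ => (φ, 0))
  | q2 {n n₀ : ℕ} (Γ Δ : Ctx) (s t : Tm 0) (h₀ : n₀ < n)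
      (d : Der m k n₀ ((eq s t, 0) ::ₘ (eq (succ s) (succ t), 0) ::ₘ Γ) Δ) :
      Der m k n ((eq (succ s) (succ t), 0) ::ₘ Γ) Δ
  | q3 {n n₀ n₁ : ℕ} (Γ Δ : Ctx2) (s : Tm 0) (y : ℕ) (h₀ : n₀ < n) (h₁ : n₁ < n)
      (hΓ : Γ.join.Fresh y) (hΔ : Δ.join.Fresh y) (hs : y ∉ s.FV)
      (d₀ : Der m k n₀ ((eq s zero, 0) ::ₘ Γ.left) Δ.left)
      (d₁ : Der m k n₁ ((eq s (succ (fv y)), 0) ::ₘ Γ.right) Δ.right) :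
      Der m k n Γ.join Δ.join
  | q4 {n n₀ : ℕ} (Γ Δ : Ctx) (s : Tm 0) (h₀ : n₀ < n)
      (d : Der m k n₀ ((eq (add s zero) s, 0) ::ₘ Γ) Δ) :
      Der m k n Γ Δ
  | q5 {n n₀ : ℕ} (Γ Δ : Ctx) (s t : Tm 0) (h₀ : n₀ < n)
      (d : Der m k n₀ ((eq (add s (succ t)) (succ (add s t)), 0) ::ₘ Γ) Δ) :
      Der m k n Γ Δ
  | q6 {n n₀ : ℕ} (Γ Δ : Ctx) (s : Tm 0) (h₀ : n₀ < n)
      (d : Der m k n₀ ((eq (mul s zero) zero, 0) ::ₘ Γ) Δ) :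
      Der m k n Γ Δ
  | q7 {n n₀ : ℕ} (Γ Δ : Ctx) (s t : Tm 0) (h₀ : n₀ < n)
      (d : Der m k n₀ ((eq (mul s (succ t)) (add (mul s t) s), 0) ::ₘ Γ) Δ) :
      Der m k n Γ Δ
  | trR {n n₀ : ℕ} (Γ Δ : Ctx) (φ : Fml 0) (i : ℕ) (h₀ : n₀ < n) (hφ : φ.IsSentence)
      (hk : i + 1 ≤ k)
      (d : Der m k n₀ Γ ((φ, i) ::ₘ Δ)) :
      Der m k n Γ ((truthOf φ, i + 1) ::ₘ Δ)
  | trL {n n₀ : ℕ} (Γ Δ : Ctx) (φ : Fml 0) (i : ℕ) (h₀ : n₀ < n) (hφ : φ.IsSentence)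
      (hk : i + 1 ≤ k)
      (d : Der m k n₀ ((φ, i) ::ₘ Γ) Δ) :
      Der m k n ((truthOf φ, i + 1) ::ₘ Γ) Δ

/-- `Provable n m k Γ Δ`: the sequent `Γ ⇒ Δ` has a derivation with length at most `n`, cut rank at
most `m` and truth complexity at most `k`. As a cut on `φ` has rank `|φ| + 1`, derivations of cut rank
`0` are the cut-free ones. -/
def Provable (n m k : ℕ) (Γ Δ : Multiset (Fml 0)) : Prop :=
  ∃ Γ' Δ' : Ctx, Γ'.forget = Γ ∧ Δ'.forget = Δ ∧ Der m k n Γ' Δ'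

/-- The hyperexponential function: `hyperexp n 0 = n` and `hyperexp n (m + 1) = 2 ^ hyperexp n m`. -/
def hyperexp (n : ℕ) : ℕ → ℕ
  | 0 => n
  | m + 1 => 2 ^ hyperexp n m

end LPTN

/-! The obstacle to the usual induction on cut rank is the truth rule: its active formula may have
any logical complexity, whereas `T l̄` has complexity 0. The remedy is to measure a cut formula by a
depth, bounding how many invertible or quantifier steps can be applied along it. In a derivation of
length `n` the length of the subderivation serves as depth, so that cut formulas have depth below
`n`. If `k = 0`, the logical complexity serves instead and cut formulas have depth below `m`.
`DepthBound` covers both choices, which explains the heights `n` and `m` of the two exponential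
towers.

`Der.toDeriv` moves to a calculus whose occurrences carry depth and truth complexity as mere upper
bounds, and in which eigenvariables are replaced by premisses for all terms. There weakening,
`Deriv.inversion` and `Deriv.contract` preserve length. `Deriv.cut_reduce` replaces a cut of depth
`r` by cuts of smaller depth: inversion handles negation, conjunction and truth, while `cut_all` and
`cut_eq` push the cut up one of the premisses. A cut on `T l̄` with bound `i + 1` becomes a cut on
the sentence with bound `i`. Removing one level of depth costs one exponential
(`Deriv.reduce_rank`).

`Deriv.realizable` returns to the original calculus by keeping, at each rule with all instances, the
premisses for a fresh variable and, in the zero-or-successor rule, for zero. The truth complexities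
stay below the bounds of the end sequent because a cut-free derivation never increases them upwards.
The factor 3 pays for a replacement rule whose two principal equations are one occurrence. -/

namespace LPTN

/-! ### Simultaneous substitution for the free variables -/

namespace Tm

/-- Simultaneous substitution of terms for the free variables of a term. -/
def subst (σ : ℕ → Tm 0) {n : ℕ} : Tm n → Tm n
  | fv x => lift (σ x)
  | bv i => bv i
  | zero => zero
  | succ t => succ (subst σ t)
  | add s t => add (subst σ s) (subst σ t)
  | mul s t => mul (subst σ s) (subst σ t)

theorem lift_zero (t : Tm 0) : (lift t : Tm 0) = t := by
  induction t with
  | bv i => exact i.elim0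
  | _ => simp_all [lift]

theorem inst_lift {n : ℕ} (s t : Tm 0) : inst s (lift t : Tm (n + 1)) = lift t := by
  induction t with
  | bv i => exact i.elim0
  | _ => simp_all [lift, inst]

theorem subst_lift {n : ℕ} (σ : ℕ → Tm 0) (t : Tm 0) :
    subst σ (lift t : Tm n) = lift (subst σ t) := by
  induction t with
  | fv x => simp [lift, subst, lift_zero]
  | bv i => exact i.elim0
  | _ => simp_all [lift, subst]

theorem subst_inst {n : ℕ} (σ : ℕ → Tm 0) (s : Tm 0) (t : Tm (n + 1)) :
    subst σ (inst s t) = inst (subst σ s) (subst σ t) := by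
  induction t with
  | fv x => simp [inst, subst, inst_lift]
  | bv i => cases i using Fin.cases <;> simp [inst, subst, subst_lift]
  | _ => simp_all [inst, subst]

theorem subst_congr {n : ℕ} {σ τ : ℕ → Tm 0} (t : Tm n) (h : ∀ x ∈ t.FV, σ x = τ x) :
    subst σ t = subst τ t := by
  induction t with
  | fv x => simp [subst, h x (by simp [FV])]
  | add s t ihs iht | mul s t ihs iht =>
    simp only [FV, Finset.mem_union] at h
    simp [subst, ihs fun x hx => h x (.inl hx), iht fun x hx => h x (.inr hx)]
  | _ => simp_all [subst, FV]

theorem subst_fv {n : ℕ} (t : Tm n) : subst fv t = t := by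
  induction t <;> simp_all [subst, lift]

theorem subst_numeral {n : ℕ} (σ : ℕ → Tm 0) (l : ℕ) :
    subst σ (numeral l : Tm n) = numeral l := by
  induction l <;> simp_all [numeral, subst]

theorem numeral_injective {n : ℕ} : Function.Injective (numeral (n := n)) := by
  intro a
  induction a with
  | zero => intro b h; cases b <;> simp_all [numeral]
  | succ a ih =>
    intro b h
    cases b with
    | zero => simp [numeral] at h
    | succ b => simp only [numeral, succ.injEq] at h; rw [ih h]

end Tm

namespace Fml

/-- Simultaneous substitution of terms for the free variables of a formula. -/
def subst (σ : ℕ → Tm 0) : {n : ℕ} → Fml n → Fml n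
  | _, bot => bot
  | _, top => top
  | _, eq s t => eq (s.subst σ) (t.subst σ)
  | _, tr t => tr (t.subst σ)
  | _, neg φ => neg (subst σ φ)
  | _, and φ ψ => and (subst σ φ) (subst σ ψ)
  | _, all φ => all (subst σ φ)

/-- Induction on an indexed family needs a free index, so `n + 1` is replaced by `k` with an
equation. -/
theorem inst_subst_aux (σ : ℕ → Tm 0) (s : Tm 0) {k : ℕ} (φ : Fml k) :
    ∀ {n : ℕ} (h : k = n + 1),
      subst σ (inst s (h ▸ φ)) = inst (s.subst σ) (subst σ (h ▸ φ : Fml (n + 1))) := by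
  induction φ with
  | all φ ih => intro n h; subst h; simpa [inst, subst] using ih rfl
  | neg φ ih => intro n h; subst h; simpa [inst, subst] using ih rfl
  | and φ ψ ih ih' => intro n h; subst h; simpa [inst, subst] using ⟨ih rfl, ih' rfl⟩
  | _ => intro n h; subst h; simp [inst, subst, Tm.subst_inst]

theorem subst_inst (σ : ℕ → Tm 0) (s : Tm 0) {n : ℕ} (φ : Fml (n + 1)) :
    subst σ (inst s φ) = inst (s.subst σ) (subst σ φ) :=
  inst_subst_aux σ s φ rfl

theorem complexity_inst_aux (s : Tm 0) {k : ℕ} (φ : Fml k) :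
    ∀ {n : ℕ} (h : k = n + 1), (inst s (h ▸ φ : Fml (n + 1))).complexity = φ.complexity := by
  induction φ with
  | all φ ih => intro n h; subst h; simpa [inst, complexity] using ih rfl
  | neg φ ih => intro n h; subst h; simpa [inst, complexity] using ih rfl
  | and φ ψ ih ih' =>
    intro n h; subst h
    have h₁ := ih rfl
    have h₂ := ih' rfl
    simp only at h₁ h₂
    simp [inst, complexity, h₁, h₂]
  | _ => intro n h; subst h; simp [inst, complexity]

theorem complexity_inst (s : Tm 0) {n : ℕ} (φ : Fml (n + 1)) :
    (inst s φ).complexity = φ.complexity :=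
  complexity_inst_aux s φ rfl

theorem subst_congr {σ τ : ℕ → Tm 0} {n : ℕ} (φ : Fml n) (h : ∀ x ∈ φ.FV, σ x = τ x) :
    subst σ φ = subst τ φ := by
  induction φ with
  | eq s t =>
    simp only [FV, Finset.mem_union] at h
    simp [subst, Tm.subst_congr s fun x hx => h x (.inl hx),
      Tm.subst_congr t fun x hx => h x (.inr hx)]
  | tr t => simp [subst, Tm.subst_congr t h]
  | and φ ψ ih ih' =>
    simp only [FV, Finset.mem_union] at h
    simp [subst, ih fun x hx => h x (.inl hx), ih' fun x hx => h x (.inr hx)]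
  | _ => simp_all [subst, FV]

theorem subst_fv {n : ℕ} (φ : Fml n) : subst Tm.fv φ = φ := by
  induction φ <;> simp_all [subst, Tm.subst_fv]

theorem IsSentence.subst_eq {φ : Fml 0} (h : φ.IsSentence) (σ : ℕ → Tm 0) : subst σ φ = φ := by
  rw [IsSentence] at h
  rw [subst_congr (τ := Tm.fv) φ (by simp [h]), subst_fv]

end Fml

theorem subst_truthOf (σ : ℕ → Tm 0) (φ : Fml 0) : (truthOf φ).subst σ = truthOf φ := by
  simp [truthOf, Fml.subst, Tm.subst_numeral]

/-- Injectivity of the coding enters only here: it makes the active sentence of a truth rule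
recoverable from the principal formula, as inversion requires. -/
theorem truthOf_injective : Function.Injective truthOf := fun _ _ h =>
  Fml.code_injective (Tm.numeral_injective (Fml.tr.inj h))

/-! ### A calculus with premisses for all instances

Both sides of a sequent are merged into one multiset of signed formula occurrences. An occurrence
carries an upper bound for its truth complexity and one for the number of times it is analysed. The
rules with an eigenvariable have one premiss for every term in place of the variable. -/

/-- A formula occurrence: `side` is `true` in the antecedent and `false` in the succedent, `tc` bounds
the truth complexity and `depth` bounds the depth to which the occurrence is analysed. -/
structure Occ where
  side : Bool
  fml : Fml 0
  tc : ℕ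
  depth : ℕ

/-- `a ≤ b` if `b` is the same signed formula with larger bounds; the bounds of equations are
irrelevant. -/
def Occ.Le (a b : Occ) : Prop :=
  a.side = b.side ∧ a.fml = b.fml ∧
    ((∃ s t, a.fml = .eq s t) ∨ (a.tc ≤ b.tc ∧ a.depth ≤ b.depth))

theorem Occ.Le.refl (a : Occ) : a.Le a := ⟨rfl, rfl, .inr ⟨le_rfl, le_rfl⟩⟩

theorem Occ.rel_refl (G : Multiset Occ) : Multiset.Rel Occ.Le G G :=
  Multiset.rel_refl_of_refl_on fun a _ => .refl a

open Fml in
/-- The invertible rules: the principal occurrence, and the set of the multisets of occurrences that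
replace it in the premisses. -/
inductive Inv : Occ → Set (Multiset Occ) → Prop
  | neg (b : Bool) (φ : Fml 0) (i d : ℕ) : Inv ⟨b, neg φ, i, d + 1⟩ {{⟨!b, φ, i, d⟩}}
  | andL (φ ψ : Fml 0) (i d : ℕ) :
      Inv ⟨true, and φ ψ, i, d + 1⟩ {{⟨true, φ, i, d⟩, ⟨true, ψ, i, d⟩}}
  | andR (φ ψ : Fml 0) (i d : ℕ) :
      Inv ⟨false, and φ ψ, i, d + 1⟩ {{⟨false, φ, i, d⟩}, {⟨false, ψ, i, d⟩}}
  | allR (φ : Fml 1) (i d : ℕ) :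
      Inv ⟨false, all φ, i, d + 1⟩ (Set.range fun s => {⟨false, φ.inst s, i, d⟩})
  | tr (b : Bool) (φ : Fml 0) (hφ : φ.IsSentence) (i d : ℕ) :
      Inv ⟨b, truthOf φ, i + 1, d + 1⟩ {{⟨b, φ, i, d⟩}}

open Fml Tm in
/-- The rules of equality and arithmetic: the set of the principal equations, and the set of the
equations that are added to the antecedent in the premisses. -/
inductive ArithRule : Set (Fml 0) → Set (Fml 0) → Prop
  | eq1 (t : Tm 0) : ArithRule ∅ {eq t t}
  | eq2 (s t : Tm 0) (a b : Tm 1) :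
      ArithRule {eq s t, eq (Tm.inst t a) (Tm.inst t b)} {eq (Tm.inst s a) (Tm.inst s b)}
  | q1 (s : Tm 0) : ArithRule {eq (succ s) zero} ∅
  | q2 (s t : Tm 0) : ArithRule {eq (succ s) (succ t)} {eq s t}
  | q3 (s : Tm 0) : ArithRule ∅ (insert (eq s zero) (Set.range fun u => eq s (succ u)))
  | q4 (s : Tm 0) : ArithRule ∅ {eq (add s zero) s}
  | q5 (s t : Tm 0) : ArithRule ∅ {eq (add s (succ t)) (succ (add s t))}
  | q6 (s : Tm 0) : ArithRule ∅ {eq (mul s zero) zero}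
  | q7 (s t : Tm 0) : ArithRule ∅ {eq (mul s (succ t)) (add (mul s t) s)}

open Fml in
/-- `Deriv r n G`: the signed sequent `G` has a derivation of length at most `n` all of whose cut
formulas have depth less than `r`. -/
inductive Deriv (r : ℕ) : ℕ → Multiset Occ → Prop
  | ref {n : ℕ} {G : Multiset Occ} {s t : Tm 0} {i d i' d' : ℕ}
      (hL : ⟨true, eq s t, i, d⟩ ∈ G) (hR : ⟨false, eq s t, i', d'⟩ ∈ G) : Deriv r n G
  | arith {n n₀ : ℕ} {G : Multiset Occ} {P J : Set (Fml 0)} (hPJ : ArithRule P J)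
      (hP : ∀ e ∈ P, ∃ i d, ⟨true, e, i, d⟩ ∈ G) (h₀ : ∀ e ∈ J, n₀ < n)
      (D : ∀ e ∈ J, Deriv r n₀ (⟨true, e, 0, 0⟩ ::ₘ G)) : Deriv r n G
  | allL {n n₀ : ℕ} {G : Multiset Occ} {φ : Fml 1} {i d : ℕ} (s : Tm 0)
      (hG : ⟨true, all φ, i, d + 1⟩ ∈ G) (h₀ : n₀ < n)
      (D : Deriv r n₀ (⟨true, φ.inst s, i, d⟩ ::ₘ G)) : Deriv r n G
  | inv {n n₀ : ℕ} {G : Multiset Occ} {a : Occ} {J : Set (Multiset Occ)} (ha : Inv a J)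
      (h₀ : n₀ < n) (D : ∀ A ∈ J, Deriv r n₀ (A + G)) : Deriv r n (a ::ₘ G)
  | cut {n n₀ n₁ : ℕ} {G : Multiset Occ} {φ : Fml 0} {i d : ℕ} (h₀ : n₀ < n) (h₁ : n₁ < n)
      (hd : d < r) (D₀ : Deriv r n₀ (⟨false, φ, i, d⟩ ::ₘ G))
      (D₁ : Deriv r n₁ (⟨true, φ, i, d⟩ ::ₘ G)) : Deriv r n G

/-! ### Principal formulas of the rules -/

theorem ArithRule.exists_eq {P J : Set (Fml 0)} (h : ArithRule P J) {e : Fml 0} (he : e ∈ P) :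
    ∃ s t, e = .eq s t := by
  cases h <;> simp only [Set.mem_insert_iff, Set.mem_singleton_iff, Set.mem_empty_iff_false] at he
  · rcases he with rfl | rfl <;> exact ⟨_, _, rfl⟩
  · exact ⟨_, _, he⟩
  · exact ⟨_, _, he⟩

theorem Inv.unique {a : Occ} {J J' : Set (Multiset Occ)} (h : Inv a J) (h' : Inv a J') :
    J = J' := by
  cases h with
  | tr b φ hφ i d =>
    generalize ha : (⟨b, truthOf φ, i + 1, d + 1⟩ : Occ) = a at h'
    cases h' <;> simp only [Occ.mk.injEq, Nat.add_right_cancel_iff] at ha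
    case tr =>
      obtain ⟨rfl, h, rfl, rfl⟩ := ha
      rw [truthOf_injective h]
    all_goals simp [truthOf] at ha
  | _ =>
    generalize ha : Occ.mk _ _ _ _ = a at h'
    cases h' <;> simp only [Occ.mk.injEq, Nat.add_right_cancel_iff] at ha <;>
      simp [truthOf] at ha <;> simp [ha]

theorem Inv.ne_eq {a : Occ} {J : Set (Multiset Occ)} (h : Inv a J) (s t : Tm 0) :
    a.fml ≠ .eq s t := by
  cases h <;> simp [truthOf]

theorem Inv.ne_allL {a : Occ} {J : Set (Multiset Occ)} (h : Inv a J) (φ : Fml 1) (i d : ℕ) :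
    a ≠ ⟨true, .all φ, i, d⟩ := by
  cases h <;> simp [truthOf]

/-- Larger bounds are still successors wherever the rule needs one, and their predecessors dominate
the old ones. -/
theorem Inv.raise {a b : Occ} {J : Set (Multiset Occ)} (h : Inv a J) (hab : a.Le b) :
    ∃ J', Inv b J' ∧ ∀ A' ∈ J', ∃ A ∈ J, Multiset.Rel Occ.Le A A' := by
  obtain ⟨b₁, φ, i', d'⟩ := b
  obtain ⟨h₁, h₂, h₃⟩ := hab
  replace h₃ := h₃.resolve_left (by rintro ⟨s, t, h'⟩; exact h.ne_eq s t h')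
  have key : ∀ {b : Bool} {φ : Fml 0} {i d i' d' : ℕ}, i ≤ i' → d ≤ d' →
      Occ.Le ⟨b, φ, i, d⟩ ⟨b, φ, i', d'⟩ := fun hi hd => ⟨rfl, rfl, .inr ⟨hi, hd⟩⟩
  cases h <;> simp only at h₁ h₂ h₃ <;> subst h₁ h₂ <;>
    obtain ⟨hi, hd⟩ := h₃ <;>
    obtain ⟨d', rfl⟩ : ∃ d, d' = d + 1 := ⟨d' - 1, by omega⟩ <;>
    replace hd := Nat.le_of_succ_le_succ hd
  · refine ⟨_, .neg .., ?_⟩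
    rintro _ rfl
    exact ⟨_, rfl, .cons (key hi hd) .zero⟩
  · refine ⟨_, .andL .., ?_⟩
    rintro _ rfl
    exact ⟨_, rfl, .cons (key hi hd) (.cons (key hi hd) .zero)⟩
  · refine ⟨_, .andR .., ?_⟩
    rintro _ (rfl | rfl)
    · exact ⟨_, .inl rfl, .cons (key hi hd) .zero⟩
    · exact ⟨_, .inr rfl, .cons (key hi hd) .zero⟩
  · refine ⟨_, .allR .., ?_⟩
    rintro _ ⟨s, rfl⟩
    exact ⟨_, ⟨s, rfl⟩, .cons (key hi hd) .zero⟩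
  · obtain ⟨i', rfl⟩ : ∃ d, i' = d + 1 := ⟨i' - 1, by omega⟩
    refine ⟨_, .tr _ _ ‹_› .., ?_⟩
    rintro _ rfl
    exact ⟨_, rfl, .cons (key (Nat.le_of_succ_le_succ hi) hd) .zero⟩

/-! ### Length-preserving structural rules -/

namespace Deriv

variable {r : ℕ}

theorem mono {n n' : ℕ} {G : Multiset Occ} (D : Deriv r n G) (h : n ≤ n') : Deriv r n' G := by
  cases D with
  | ref hL hR => exact ref hL hR
  | arith hPJ hP h₀ D => exact arith hPJ hP (fun e he => (h₀ e he).trans_le h) D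
  | allL s hG h₀ D => exact allL s hG (h₀.trans_le h) D
  | inv ha h₀ D => exact inv ha (h₀.trans_le h) D
  | cut h₀ h₁ hd D₀ D₁ => exact cut (h₀.trans_le h) (h₁.trans_le h) hd D₀ D₁

theorem weaken {n : ℕ} {G : Multiset Occ} (D : Deriv r n G) (H : Multiset Occ) :
    Deriv r n (G + H) := by
  have hm : ∀ {G : Multiset Occ} {a : Occ}, a ∈ G → a ∈ G + H := fun h =>
    Multiset.mem_add.2 (.inl h)
  induction D with
  | ref hL hR => exact ref (hm hL) (hm hR)
  | arith hPJ hP h₀ D ih =>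
    exact arith hPJ (fun e he => (hP e he).imp fun i => .imp fun d => hm) h₀
      fun e he => by simpa using ih e he
  | allL s hG h₀ D ih => exact allL s (hm hG) h₀ (by simpa using ih)
  | inv ha h₀ D ih =>
    rw [Multiset.cons_add]
    exact inv ha h₀ fun A hA => by simpa [add_assoc] using ih A hA
  | cut h₀ h₁ hd D₀ D₁ ih₀ ih₁ => exact cut h₀ h₁ hd (by simpa using ih₀) (by simpa using ih₁)

theorem weaken_cons {n : ℕ} {G : Multiset Occ} (D : Deriv r n G) (a : Occ) :
    Deriv r n (a ::ₘ G) := by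
  rw [← Multiset.singleton_add, add_comm]
  exact D.weaken {a}

theorem raise {n : ℕ} {G G' : Multiset Occ} (D : Deriv r n G) (h : Multiset.Rel Occ.Le G G') :
    Deriv r n G' := by
  have hm : ∀ {G G' : Multiset Occ} {b φ i d}, Multiset.Rel Occ.Le G G' → ⟨b, φ, i, d⟩ ∈ G →
      ∃ i' d', ⟨b, φ, i', d'⟩ ∈ G' ∧ ((∃ s t, φ = .eq s t) ∨ (i ≤ i' ∧ d ≤ d')) := by
    intro G G' b φ i d h hG
    obtain ⟨⟨b', φ', i', d'⟩, h₁, h₂, h₃, h₄⟩ := Multiset.exists_mem_of_rel_of_mem h hG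
    obtain rfl : b = b' := h₂
    obtain rfl : φ = φ' := h₃
    exact ⟨i', d', h₁, h₄⟩
  induction D generalizing G' with
  | ref hL hR =>
    obtain ⟨i, d, hL, -⟩ := hm h hL
    obtain ⟨i', d', hR, -⟩ := hm h hR
    exact ref hL hR
  | arith hPJ hP h₀ D ih =>
    refine arith hPJ (fun e he => ?_) h₀ fun e he => ih e he (.cons (.refl _) h)
    obtain ⟨i, d, hG⟩ := hP e he
    obtain ⟨i', d', hG', -⟩ := hm h hG
    exact ⟨i', d', hG'⟩
  | allL s hG h₀ D ih =>
    obtain ⟨i', d', hG', hle⟩ := hm h hG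
    have hle := hle.resolve_left (by simp)
    obtain ⟨d', rfl⟩ : ∃ d, d' = d + 1 := ⟨d' - 1, by omega⟩
    exact allL s hG' h₀ (ih (.cons ⟨rfl, rfl, .inr ⟨hle.1, by simpa using hle.2⟩⟩ h))
  | inv ha h₀ D ih =>
    obtain ⟨b, G', hab, hG, rfl⟩ := Multiset.rel_cons_left.1 h
    obtain ⟨J', hb, hJ⟩ := ha.raise hab
    refine inv hb h₀ fun A' hA' => ?_
    obtain ⟨A, hA, hAA⟩ := hJ A' hA'
    exact ih A hA (hAA.add hG)
  | cut h₀ h₁ hd D₀ D₁ ih₀ ih₁ =>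
    exact cut h₀ h₁ hd (ih₀ (.cons (.refl _) h)) (ih₁ (.cons (.refl _) h))

/-- Only `inv` can use `a` as principal occurrence: the initial sequents and arithmetical rules use
equations, and `allL` uses universal formulas of the antecedent. All other inferences commute with
the replacement of `a`. -/
theorem inversion {n : ℕ} {G : Multiset Occ} {a : Occ} {J : Set (Multiset Occ)}
    {A : Multiset Occ} (D : Deriv r n (a ::ₘ G)) (ha : Inv a J) (hA : A ∈ J) :
    Deriv r n (A + G) := by
  generalize hH : a ::ₘ G = H at D
  have hm : ∀ {G : Multiset Occ} {b : Occ}, b ≠ a → b ∈ a ::ₘ G → b ∈ A + G := fun hb h =>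
    Multiset.mem_add.2 (.inr ((Multiset.mem_cons.1 h).resolve_left hb))
  have he : ∀ {b s t i d}, (⟨b, .eq s t, i, d⟩ : Occ) ≠ a := by
    rintro b s t i d rfl
    exact ha.ne_eq s t rfl
  induction D generalizing G with
  | ref hL hR => subst hH; exact ref (hm he hL) (hm he hR)
  | arith hPJ hP h₀ D ih =>
    subst hH
    refine arith hPJ (fun e h => ?_) h₀ fun e h => ?_
    · obtain ⟨s, t, rfl⟩ := hPJ.exists_eq h
      exact (hP _ h).imp fun i => .imp fun d => hm he
    · simpa using ih e h (Multiset.cons_swap ..)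
  | allL s hG h₀ D ih =>
    subst hH
    exact allL s (hm (ha.ne_allL _ _ _).symm hG) h₀ (by simpa using ih (Multiset.cons_swap ..))
  | @inv n n₀ G' b J' hb h₀ D ih =>
    rcases Multiset.cons_eq_cons.1 hH with ⟨rfl, rfl⟩ | ⟨hab, G'', rfl, rfl⟩
    -- The last rule analyses `a` itself, so the desired sequent is one of its premisses.
    · obtain rfl := ha.unique hb
      exact (D A hA).mono h₀.le
    · rw [Multiset.add_cons]
      refine inv hb h₀ fun B hB => ?_
      rw [add_left_comm]
      exact ih B hB (by simp)
  | cut h₀ h₁ hd D₀ D₁ ih₀ ih₁ =>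
    subst hH
    exact cut h₀ h₁ hd (by simpa using ih₀ (Multiset.cons_swap ..))
      (by simpa using ih₁ (Multiset.cons_swap ..))

/-- Induction on the length rather than on the derivation, since the premisses are inverted before
the induction hypothesis is applied to them. -/
theorem contract_cons {n : ℕ} {G : Multiset Occ} {a : Occ} (D : Deriv r n (a ::ₘ a ::ₘ G)) :
    Deriv r n (a ::ₘ G) := by
  induction n using Nat.strong_induction_on generalizing a G with
  | _ n ih =>
  have hm : ∀ {b : Occ}, b ∈ a ::ₘ a ::ₘ G → b ∈ a ::ₘ G := by simp
  have hs : ∀ b c : Occ, c ::ₘ b ::ₘ b ::ₘ G = b ::ₘ b ::ₘ c ::ₘ G := fun b c => by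
    rw [Multiset.cons_swap c, Multiset.cons_swap c]
  generalize hH : a ::ₘ a ::ₘ G = H at D
  cases D with
  | ref hL hR => subst hH; exact ref (hm hL) (hm hR)
  | arith hPJ hP h₀ D =>
    subst hH
    refine arith hPJ (fun e h => (hP _ h).imp fun i => .imp fun d => hm) h₀ fun e h => ?_
    have := D e h
    rw [hs] at this
    rw [Multiset.cons_swap]
    exact ih _ (h₀ e h) this
  | allL s hG h₀ D =>
    subst hH
    refine allL s (hm hG) h₀ ?_
    rw [hs] at D
    rw [Multiset.cons_swap]
    exact ih _ h₀ D
  | @inv _ n₀ G' b J hb h₀ D =>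
    have hadd : ∀ (A : Multiset Occ) {H : Multiset Occ}, Deriv r n₀ (A + (A + H)) →
        Deriv r n₀ (A + H) := by
      intro A
      induction A using Multiset.induction with
      | empty => simp
      | cons c A ihA =>
        intro H D
        rw [Multiset.cons_add, Multiset.cons_add, Multiset.add_cons] at D
        have D := ih _ h₀ D
        rw [← Multiset.add_cons, ← Multiset.add_cons] at D
        simpa using ihA D
    rcases Multiset.cons_eq_cons.1 hH with ⟨rfl, rfl⟩ | ⟨hab, G'', hG, rfl⟩
    -- One copy is principal and the other survives in the premiss. Inverting the latter gives a
    -- second copy of `A`, and both copies are contracted at the smaller length.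
    · refine inv hb h₀ fun A hA => hadd A ?_
      have D := D A hA
      rw [Multiset.add_cons] at D
      exact D.inversion hb hA
    · rcases Multiset.cons_eq_cons.1 hG with ⟨rfl, rfl⟩ | ⟨-, G', rfl, rfl⟩
      · exact absurd rfl hab
      · rw [Multiset.cons_swap]
        refine inv hb h₀ fun A hA => ?_
        have D := D A hA
        rw [Multiset.add_cons, Multiset.add_cons] at D
        simpa using ih _ h₀ D
  | cut h₀ h₁ hd D₀ D₁ =>
    subst hH
    rw [hs] at D₀ D₁
    have D₀ := ih _ h₀ D₀
    have D₁ := ih _ h₁ D₁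
    rw [Multiset.cons_swap] at D₀ D₁
    exact cut h₀ h₁ hd D₀ D₁

theorem contract {n : ℕ} (G : Multiset Occ) : ∀ {H : Multiset Occ}, Deriv r n (G + (G + H)) →
    Deriv r n (G + H) := by
  induction G using Multiset.induction with
  | empty => simp
  | cons a G ih =>
    intro H D
    rw [Multiset.cons_add, Multiset.cons_add, Multiset.add_cons] at D
    have D := D.contract_cons
    rw [← Multiset.add_cons, ← Multiset.add_cons] at D
    simpa using ih D

/-! ### Reduction of cuts -/

/-- A formula in the succedent that is neither an equation nor the principal formula of an invertible
rule can be deleted. -/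
theorem strengthen {n : ℕ} {G : Multiset Occ} {φ : Fml 0} {i d : ℕ}
    (D : Deriv r n (⟨false, φ, i, d⟩ ::ₘ G)) (hφ : ∀ s t, φ ≠ .eq s t)
    (hI : ∀ J, ¬ Inv ⟨false, φ, i, d⟩ J) : Deriv r n G := by
  generalize hH : _ ::ₘ G = H at D
  induction D generalizing G with
  | ref hL hR =>
    subst hH
    refine ref (by simpa using hL) ((Multiset.mem_cons.1 hR).resolve_left ?_)
    simp [(hφ _ _).symm]
  | arith hPJ hP h₀ D ih =>
    subst hH
    exact arith hPJ (fun e h => by simpa using hP e h) h₀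
      fun e h => ih e h (Multiset.cons_swap ..)
  | allL s hG h₀ D ih =>
    subst hH
    exact allL s (by simpa using hG) h₀ (ih (Multiset.cons_swap ..))
  | inv hb h₀ D ih =>
    rcases Multiset.cons_eq_cons.1 hH with ⟨rfl, rfl⟩ | ⟨hab, G'', rfl, rfl⟩
    · exact absurd hb (hI _)
    · exact inv hb h₀ fun B hB => ih B hB (by simp)
  | cut h₀ h₁ hd D₀ D₁ ih₀ ih₁ =>
    subst hH
    exact cut h₀ h₁ hd (ih₀ (Multiset.cons_swap ..)) (ih₁ (Multiset.cons_swap ..))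

/-- Formulas other than equations can be deleted from an initial sequent. -/
theorem strengthen_initial {n : ℕ} {G : Multiset Occ} {a : Occ} (D : Deriv r 0 (a ::ₘ G))
    (ha : ∀ s t, a.fml ≠ .eq s t) : Deriv r n G := by
  have hm : ∀ {b s t i d}, ⟨b, .eq s t, i, d⟩ ∈ a ::ₘ G → ⟨b, .eq s t, i, d⟩ ∈ G :=
    fun h => (Multiset.mem_cons.1 h).resolve_left (by rintro rfl; exact ha _ _ rfl)
  generalize hH : a ::ₘ G = H at D
  cases D with
  | ref hL hR => subst hH; exact ref (hm hL) (hm hR)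
  | arith hPJ hP h₀ D =>
    subst hH
    refine arith (n₀ := 0) hPJ (fun e h => ?_) (fun e h => absurd (h₀ e h) (by omega))
      fun e h => absurd (h₀ e h) (by omega)
    obtain ⟨s, t, rfl⟩ := hPJ.exists_eq h
    exact (hP _ h).imp fun i => .imp fun d => hm
  | allL s hG h₀ D => omega
  | inv hb h₀ D => omega
  | cut h₀ h₁ hd D₀ D₁ => omega

/-- In the succedent an equation is used by initial sequents only. At such a leaf the equation also
stands in the antecedent, so the second derivation, weakened, can be put in its place. No new cut
arises. -/
theorem cut_eq {n₀ n₁ : ℕ} {G H : Multiset Occ} {s t : Tm 0} {i d i' d' : ℕ}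
    (D₀ : Deriv r n₀ (⟨false, .eq s t, i, d⟩ ::ₘ G))
    (D₁ : Deriv r n₁ (⟨true, .eq s t, i', d'⟩ ::ₘ H)) : Deriv r (n₀ + n₁) (G + H) := by
  have hm : ∀ {G : Multiset Occ} {a b : Occ}, a ∈ b ::ₘ G → a ≠ b → a ∈ G + H := fun h hab =>
    Multiset.mem_add.2 (.inl ((Multiset.mem_cons.1 h).resolve_left hab))
  generalize hG : _ ::ₘ G = G' at D₀
  induction D₀ generalizing G with
  | @ref n _ s' t' i₁ d₁ i₂ d₂ hL hR =>
    subst hG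
    replace hL := (Multiset.mem_cons.1 hL).resolve_left (by simp)
    rcases Multiset.mem_cons.1 hR with h | hR
    · simp only [Occ.mk.injEq, Fml.eq.injEq, true_and] at h
      obtain ⟨⟨rfl, rfl⟩, -⟩ := h
      obtain ⟨G, rfl⟩ := Multiset.exists_cons_of_mem hL
      -- The bounds of the two occurrences need not agree; this is why `Occ.Le` ignores them on
      -- equations.
      have D := D₁.raise (G' := ⟨true, .eq s' t', i₁, d₁⟩ ::ₘ H)
        (.cons ⟨rfl, rfl, .inl ⟨_, _, rfl⟩⟩ (Occ.rel_refl _))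
      exact (by simpa [add_comm] using D.weaken G : Deriv r n₁ _).mono (by omega)
    · exact ref (Multiset.mem_add.2 (.inl hL)) (Multiset.mem_add.2 (.inl hR))
  | arith hPJ hP h₀ D ih =>
    subst hG
    refine arith hPJ (fun e h => (hP e h).imp fun i => .imp fun d h => hm h (by simp))
      (fun e h => Nat.add_lt_add_right (h₀ e h) n₁) fun e h => ?_
    simpa using ih e h (Multiset.cons_swap ..)
  | allL s hG' h₀ D ih =>
    subst hG
    exact allL s (hm hG' (by simp)) (Nat.add_lt_add_right h₀ n₁)
      (by simpa using ih (Multiset.cons_swap ..))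
  | inv hb h₀ D ih =>
    rcases Multiset.cons_eq_cons.1 hG with ⟨rfl, rfl⟩ | ⟨hab, G'', rfl, rfl⟩
    · exact absurd rfl (hb.ne_eq s t)
    · rw [Multiset.cons_add]
      refine inv hb (Nat.add_lt_add_right h₀ n₁) fun B hB => ?_
      rw [← add_assoc]
      exact ih B hB (by simp)
  | cut h₀ h₁ hd D₀ D₁ ih₀ ih₁ =>
    subst hG
    exact cut (Nat.add_lt_add_right h₀ n₁) (Nat.add_lt_add_right h₁ n₁) hd
      (by simpa using ih₀ (Multiset.cons_swap ..)) (by simpa using ih₁ (Multiset.cons_swap ..))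

/-- The universal formula in the antecedent is not invertible, so the induction runs over its
derivation: each inference on it, with instance `s`, becomes a cut of depth `d` with the
corresponding instance of `D₀`. -/
theorem cut_all {n₀ n₁ : ℕ} {G H : Multiset Occ} {φ : Fml 1} {i d : ℕ} (hd : d < r)
    (D₀ : ∀ s, Deriv r n₀ (⟨false, φ.inst s, i, d⟩ ::ₘ G))
    (D₁ : Deriv r n₁ (⟨true, .all φ, i, d + 1⟩ ::ₘ H)) : Deriv r (n₀ + n₁) (G + H) := by
  have hm : ∀ {H : Multiset Occ} {a b : Occ}, a ∈ b ::ₘ H → a ≠ b → a ∈ G + H := fun h hab =>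
    Multiset.mem_add.2 (.inr ((Multiset.mem_cons.1 h).resolve_left hab))
  generalize hH : _ ::ₘ H = H' at D₁
  induction D₁ generalizing H with
  | ref hL hR =>
    subst hH
    exact ref (hm hL (by simp)) (hm hR (by simp))
  | arith hPJ hP h₀ D ih =>
    subst hH
    refine arith hPJ (fun e h => ?_) (fun e h => Nat.add_lt_add_left (h₀ e h) n₀) fun e h => ?_
    · obtain ⟨s, t, rfl⟩ := hPJ.exists_eq h
      exact (hP _ h).imp fun i => .imp fun d h => hm h (by simp)
    · simpa using ih e h (Multiset.cons_swap ..)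
  | @allL n n₁ _ ψ i' d' s hG' h₀ D ih =>
    subst hH
    have D' : Deriv r (n₀ + n₁) (⟨true, ψ.inst s, i', d'⟩ ::ₘ (G + H)) := by
      simpa using ih (Multiset.cons_swap ..)
    rcases Multiset.mem_cons.1 hG' with h | h
    · simp only [Occ.mk.injEq, Fml.all.injEq, true_and, Nat.add_right_cancel_iff] at h
      obtain ⟨rfl, rfl, rfl⟩ := h
      exact cut (n₀ := n₀) (n₁ := n₀ + n₁) (by omega) (by omega) hd
        (by simpa using (D₀ s).weaken H) D'
    · exact allL s (Multiset.mem_add.2 (.inr h)) (Nat.add_lt_add_left h₀ n₀) D'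
  | inv hb h₀ D ih =>
    rcases Multiset.cons_eq_cons.1 hH with ⟨rfl, rfl⟩ | ⟨hab, H', rfl, rfl⟩
    · exact absurd rfl (hb.ne_allL _ _ _)
    · rw [Multiset.add_cons]
      refine inv hb (Nat.add_lt_add_left h₀ n₀) fun B hB => ?_
      rw [add_left_comm]
      exact ih B hB (by simp)
  | cut h₀ h₁ hd D₀ D₁ ih₀ ih₁ =>
    subst hH
    exact cut (Nat.add_lt_add_left h₀ n₀) (Nat.add_lt_add_left h₁ n₀) hd
      (by simpa using ih₀ (Multiset.cons_swap ..)) (by simpa using ih₁ (Multiset.cons_swap ..))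

/-- A cut on a formula of depth `r` is reduced to cuts on formulas of smaller depth. -/
theorem cut_reduce {n₀ n₁ : ℕ} {G : Multiset Occ} {φ : Fml 0} {i : ℕ}
    (D₀ : Deriv r n₀ (⟨false, φ, i, r⟩ ::ₘ G)) (D₁ : Deriv r n₁ (⟨true, φ, i, r⟩ ::ₘ G)) :
    Deriv r (n₀ + n₁ + 1) G := by
  by_cases hφ : ∃ s t, φ = .eq s t
  · obtain ⟨s, t, rfl⟩ := hφ
    have D := D₀.cut_eq D₁
    rw [← add_zero G, add_assoc, zero_add] at D
    simpa using (D.contract (H := 0)).mono (Nat.le_succ _)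
  push Not at hφ
  -- Failure covers `⊤`, `⊥`, `T t` with `t` not the code of a sentence, and occurrences with
  -- exhausted bounds. The right-hand occurrence is then never active.
  by_cases hI : ∃ J, Inv ⟨false, φ, i, r⟩ J
  swap
  · push Not at hI
    exact (D₀.strengthen hφ hI).mono (by omega)
  obtain ⟨J, hJ⟩ := hI
  cases hJ with
  | neg _ ψ _ d =>
    have E₀ := D₀.inversion (.neg ..) rfl
    have E₁ := D₁.inversion (.neg ..) rfl
    exact cut (n₀ := n₁) (n₁ := n₀) (by omega) (by omega) d.lt_succ_self E₁ E₀
  | andR ψ χ _ d =>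
    -- Two nested cuts give length `max n₀ n₁ + 2`, which is at most `n₀ + n₁ + 1` only if both
    -- lengths are positive.
    rcases Nat.eq_zero_or_pos n₀ with rfl | h₀
    · exact D₀.strengthen_initial hφ
    rcases Nat.eq_zero_or_pos n₁ with rfl | h₁
    · exact D₁.strengthen_initial hφ
    have E₀ := D₀.inversion (.andR ..) (.inl rfl)
    have E₀' := D₀.inversion (.andR ..) (.inr rfl)
    have E₁ := D₁.inversion (.andL ..) rfl
    have E : Deriv (d + 1) (max n₀ n₁ + 1) (⟨true, χ, i, d⟩ ::ₘ G) := by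
      refine cut (φ := ψ) (i := i) (n₀ := n₀) (n₁ := n₁) (by omega) (by omega) d.lt_succ_self ?_
        (by simpa using E₁)
      rw [Multiset.cons_swap]
      exact E₀.weaken_cons _
    exact cut (n₀ := n₀) (by omega) (by omega) d.lt_succ_self E₀' E
  | allR ψ _ d =>
    have E₀ : ∀ s, Deriv (d + 1) n₀ (⟨false, ψ.inst s, i, d⟩ ::ₘ G) := fun s =>
      D₀.inversion (.allR ..) ⟨s, rfl⟩
    have D := cut_all d.lt_succ_self E₀ D₁
    rw [← add_zero G, add_assoc, zero_add] at D
    simpa using (D.contract (H := 0)).mono (Nat.le_succ _)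
  | tr _ ψ hψ j d =>
    have E₀ := D₀.inversion (.tr _ _ hψ _ _) rfl
    have E₁ := D₁.inversion (.tr _ _ hψ _ _) rfl
    exact cut (n₀ := n₀) (n₁ := n₁) (by omega) (by omega) d.lt_succ_self E₀ E₁

/-- The bound `f n = 2 ^ n - 1` satisfies `f n₀ + f n₁ + 1 ≤ f n` for `n₀, n₁ < n`, which is what
`cut_reduce` demands. -/
theorem reduce_rank {n : ℕ} {G : Multiset Occ} (D : Deriv (r + 1) n G) :
    Deriv r (2 ^ n - 1) G := by
  have hlt : ∀ {n₀ n : ℕ}, n₀ < n → 2 ^ n₀ - 1 < 2 ^ n - 1 := fun {n₀ n} h => by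
    have := Nat.pow_lt_pow_right (a := 2) (by omega) h
    have := Nat.one_le_two_pow (n := n₀)
    omega
  induction D with
  | ref hL hR => exact ref hL hR
  | arith hPJ hP h₀ D ih => exact arith hPJ hP (fun e he => hlt (h₀ e he)) ih
  | allL s hG h₀ D ih => exact allL s hG (hlt h₀) ih
  | inv ha h₀ D ih => exact inv ha (hlt h₀) ih
  | @cut n n₀ n₁ G φ i d h₀ h₁ hd D₀ D₁ ih₀ ih₁ =>
    rcases Nat.lt_succ_iff_lt_or_eq.1 hd with hd | rfl
    · exact cut (hlt h₀) (hlt h₁) hd ih₀ ih₁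
    · refine (cut_reduce ih₀ ih₁).mono ?_
      obtain ⟨n, rfl⟩ : ∃ k, n = k + 1 := ⟨n - 1, by omega⟩
      have e₀ := Nat.pow_le_pow_right (n := 2) (by omega) (Nat.lt_succ_iff.1 h₀)
      have e₁ := Nat.pow_le_pow_right (n := 2) (by omega) (Nat.lt_succ_iff.1 h₁)
      have := Nat.one_le_two_pow (n := n₀)
      have := Nat.one_le_two_pow (n := n₁)
      rw [pow_succ]
      omega

end Deriv

/-- Rank reduction adds its exponential at the top of the tower, the recursion for `hyperexp` at the
bottom. -/
theorem hyperexp_two_pow (n m : ℕ) : hyperexp (2 ^ n) m = hyperexp n (m + 1) := by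
  induction m with
  | zero => rfl
  | succ m ih => rw [hyperexp, ih]; rfl

theorem Deriv.cut_elimination {r n : ℕ} {G : Multiset Occ} (D : Deriv r n G) :
    Deriv 0 (hyperexp n r) G := by
  induction r generalizing n with
  | zero => exact D
  | succ r ih =>
    rw [← hyperexp_two_pow]
    exact ih (D.reduce_rank.mono (Nat.sub_le _ _))

/-! ### From derivations with eigenvariables to derivations with all instances -/

/-- A function assigning to the length of a derivation and the complexity of a formula a bound for
the depth of the analysis of that formula in that derivation, for derivations of length at most `N`,
cut rank `m` and truth complexity `k`. The cut formulas have depth less than `r`. -/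
structure DepthBound (m k N r : ℕ) (δ : ℕ → ℕ → ℕ) : Prop where
  mono {n n' : ℕ} (c : ℕ) : n ≤ n' → δ n c ≤ δ n' c
  step {n n' c c' : ℕ} : n < n' → c < c' → δ n c < δ n' c'
  truth {n n' : ℕ} (c : ℕ) : 1 ≤ k → n < n' → δ n c < δ n' 0
  cut {n c : ℕ} : n < N → c + 1 ≤ m → δ n c < r

theorem DepthBound.length (m k n : ℕ) : DepthBound m k n n fun n _ => n :=
  ⟨fun _ h => h, fun h _ => h, fun _ _ h => h, fun h _ => h⟩

/-- Logical complexity fails to decrease at a truth rule; for `k = 0` that condition is vacuous. -/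
theorem DepthBound.complexity (m n : ℕ) : DepthBound m 0 n m fun _ c => c :=
  ⟨fun _ _ => le_rfl, fun _ h => h, fun _ h => absurd h (by omega), fun _ h => h⟩

/-- The occurrence that corresponds to a formula with its truth complexity. -/
def occ (δ : ℕ → ℕ → ℕ) (σ : ℕ → Tm 0) (n : ℕ) (b : Bool) (a : Fml 0 × ℕ) : Occ :=
  ⟨b, a.1.subst σ, a.2, δ n a.1.complexity⟩

/-- The signed sequent that corresponds to a sequent with truth complexities. -/
def occs (δ : ℕ → ℕ → ℕ) (σ : ℕ → Tm 0) (n : ℕ) (Γ Δ : Ctx) : Multiset Occ :=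
  Γ.map (occ δ σ n true) + Δ.map (occ δ σ n false)

section

variable {m k N r : ℕ} {δ : ℕ → ℕ → ℕ} {σ : ℕ → Tm 0} {n n₀ : ℕ} {Γ Δ : Ctx}

theorem occs_cons_left (a : Fml 0 × ℕ) :
    occs δ σ n (a ::ₘ Γ) Δ = occ δ σ n true a ::ₘ occs δ σ n Γ Δ := by
  simp [occs]

theorem occs_cons_right (a : Fml 0 × ℕ) :
    occs δ σ n Γ (a ::ₘ Δ) = occ δ σ n false a ::ₘ occs δ σ n Γ Δ := by
  simp [occs]

theorem DepthBound.rel_map {α : Type*} (hδ : DepthBound m k N r δ) (h : n₀ ≤ n) (b : Bool)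
    (f g : α → Fml 0 × ℕ) (hfg : ∀ x, (f x).1 = (g x).1 ∧ (f x).2 ≤ (g x).2) (M : Multiset α) :
    Multiset.Rel Occ.Le ((M.map f).map (occ δ σ n₀ b)) ((M.map g).map (occ δ σ n b)) := by
  rw [Multiset.map_map, Multiset.map_map, Multiset.rel_map]
  refine Multiset.rel_refl_of_refl_on fun x _ => ⟨rfl, ?_, .inr ⟨(hfg x).2, ?_⟩⟩
  · simp [occ, (hfg x).1]
  · simpa [occ, (hfg x).1] using hδ.mono _ h

theorem DepthBound.rel_occs (hδ : DepthBound m k N r δ) (h : n₀ ≤ n) :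
    Multiset.Rel Occ.Le (occs δ σ n₀ Γ Δ) (occs δ σ n Γ Δ) := by
  have := fun b Γ => hδ.rel_map (σ := σ) h b id id (fun _ => ⟨rfl, le_rfl⟩) Γ
  simp only [Multiset.map_id] at this
  exact (this _ _).add (this _ _)

theorem DepthBound.rel_left (hδ : DepthBound m k N r δ) (h : n₀ ≤ n) (Γ Δ : Ctx2) :
    Multiset.Rel Occ.Le (occs δ σ n₀ Γ.left Δ.left) (occs δ σ n Γ.join Δ.join) :=
  have key := fun b Γ => hδ.rel_map (σ := σ) h b (fun a : Fml 0 × ℕ × ℕ => (a.1, a.2.1))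
    (fun a => (a.1, max a.2.1 a.2.2)) (fun _ => ⟨rfl, le_max_left _ _⟩) Γ
  (key true Γ).add (key false Δ)

theorem DepthBound.rel_right (hδ : DepthBound m k N r δ) (h : n₀ ≤ n) (Γ Δ : Ctx2) :
    Multiset.Rel Occ.Le (occs δ σ n₀ Γ.right Δ.right) (occs δ σ n Γ.join Δ.join) :=
  have key := fun b Γ => hδ.rel_map (σ := σ) h b (fun a : Fml 0 × ℕ × ℕ => (a.1, a.2.2))
    (fun a => (a.1, max a.2.1 a.2.2)) (fun _ => ⟨rfl, le_max_right _ _⟩) Γ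
  (key true Γ).add (key false Δ)

theorem map_occ_update {y : ℕ} (hΓ : Γ.Fresh y) (b : Bool) (s : Tm 0) :
    Γ.map (occ δ (Function.update σ y s) n b) = Γ.map (occ δ σ n b) := by
  refine Multiset.map_congr rfl fun a ha => ?_
  rw [occ, occ, Fml.subst_congr (τ := σ) a.1]
  intro x hx
  rw [Function.update_of_ne]
  rintro rfl
  exact hΓ a ha hx

theorem occs_update {y : ℕ} (hΓ : Γ.Fresh y) (hΔ : Δ.Fresh y) (s : Tm 0) :
    occs δ (Function.update σ y s) n Γ Δ = occs δ σ n Γ Δ := by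
  rw [occs, map_occ_update hΓ, map_occ_update hΔ, occs]

theorem Ctx2.fresh_right {y : ℕ} {Γ : Ctx2} (h : Γ.join.Fresh y) : Γ.right.Fresh y := by
  rw [Ctx.Fresh, Ctx2.join, Multiset.forall_mem_map_iff] at h
  rwa [Ctx.Fresh, Ctx2.right, Multiset.forall_mem_map_iff]

theorem Occ.rel_cons {b : Bool} {φ : Fml 0} {i d i' d' : ℕ} {G G' : Multiset Occ} (hi : i ≤ i')
    (hd : d ≤ d') (h : Multiset.Rel Occ.Le G G') :
    Multiset.Rel Occ.Le (⟨b, φ, i, d⟩ ::ₘ G) (⟨b, φ, i', d'⟩ ::ₘ G') :=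
  .cons ⟨rfl, rfl, .inr ⟨hi, hd⟩⟩ h

theorem Occ.rel_cons_eq {b : Bool} {s t : Tm 0} {i d i' d' : ℕ} {G G' : Multiset Occ}
    (h : Multiset.Rel Occ.Le G G') :
    Multiset.Rel Occ.Le (⟨b, .eq s t, i, d⟩ ::ₘ G) (⟨b, .eq s t, i', d'⟩ ::ₘ G') :=
  .cons ⟨rfl, rfl, .inl ⟨_, _, rfl⟩⟩ h

/-- An arithmetical rule with a single premiss. -/
theorem Deriv.arith_singleton {G G' : Multiset Occ} {P : Set (Fml 0)} {s t : Tm 0} {i d : ℕ}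
    (hP : ArithRule P {.eq s t}) (hG : ∀ e ∈ P, ∃ i d, ⟨true, e, i, d⟩ ∈ G) (h₀ : n₀ < n)
    (hG' : Multiset.Rel Occ.Le G' G) (D : Deriv r n₀ (⟨true, .eq s t, i, d⟩ ::ₘ G')) :
    Deriv r n G := by
  refine .arith hP hG (fun _ _ => h₀) ?_
  rintro _ rfl
  exact D.raise (Occ.rel_cons_eq hG')

/-- The statement holds for all `σ` at once, so that one premiss with an eigenvariable yields the
premisses for all terms. Depths computed from the shorter premisses are raised to those of the
conclusion. -/
theorem Der.toDeriv (hδ : DepthBound m k N r δ) (D : Der m k n Γ Δ) (hn : n ≤ N) :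
    Deriv r n (occs δ σ n Γ Δ) := by
  have pred : ∀ {a b : ℕ}, a < b → ∃ c, b = c + 1 ∧ a ≤ c := fun {a b} h =>
    ⟨b - 1, by omega, by omega⟩
  induction D generalizing σ with
  | ref n Γ Δ s t =>
    rw [occs_cons_left, occs_cons_right]
    exact .ref (Multiset.mem_cons_self _ _)
      (Multiset.mem_cons_of_mem (Multiset.mem_cons_self _ _))
  | @cut n n₀ n₁ Γ Δ φ i j h₀ h₁ hm d₀ d₁ ih₀ ih₁ =>
    have D₀ := ih₀ (σ := σ) (by omega)
    have D₁ := ih₁ (σ := σ) (by omega)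
    rw [occs_cons_right] at D₀
    rw [occs_cons_left] at D₁
    -- The two occurrences of the cut formula have different bounds; both are raised to the maximum.
    -- The truth bound of a cut formula need not be controlled here, as the cut will disappear.
    refine .cut (i := max i j) (d := max (δ n₀ φ.complexity) (δ n₁ φ.complexity)) h₀ h₁
      (max_lt (hδ.cut (by omega) hm) (hδ.cut (by omega) hm))
      (D₀.raise (Occ.rel_cons ?_ ?_ (hδ.rel_left h₀.le Γ Δ)))
      (D₁.raise (Occ.rel_cons ?_ ?_ (hδ.rel_right h₁.le Γ Δ))) <;> simp
  | @negL n n₀ Γ Δ φ i h₀ d ih =>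
    have D := ih (σ := σ) (by omega)
    rw [occs_cons_right] at D
    rw [occs_cons_left]
    obtain ⟨e, he, hle⟩ := pred (hδ.step h₀ φ.complexity.lt_succ_self)
    rw [occ, Fml.complexity, he]
    refine .inv (.neg ..) h₀ ?_
    rintro _ rfl
    exact D.raise (Occ.rel_cons le_rfl hle (hδ.rel_occs h₀.le))
  | @negR n n₀ Γ Δ φ i h₀ d ih =>
    have D := ih (σ := σ) (by omega)
    rw [occs_cons_left] at D
    rw [occs_cons_right]
    obtain ⟨e, he, hle⟩ := pred (hδ.step h₀ φ.complexity.lt_succ_self)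
    rw [occ, Fml.complexity, he]
    refine .inv (.neg ..) h₀ ?_
    rintro _ rfl
    exact D.raise (Occ.rel_cons le_rfl hle (hδ.rel_occs h₀.le))
  | @andL n n₀ Γ Δ φ ψ i j h₀ d ih =>
    have D := ih (σ := σ) (by omega)
    rw [occs_cons_left, occs_cons_left] at D
    rw [occs_cons_left]
    have h₁ := hδ.step h₀ (Nat.lt_succ_of_le (le_max_left φ.complexity ψ.complexity))
    have h₂ := hδ.step h₀ (Nat.lt_succ_of_le (le_max_right φ.complexity ψ.complexity))
    obtain ⟨e, he, hle⟩ := pred h₁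
    rw [occ, Fml.complexity, he]
    refine .inv (.andL ..) h₀ ?_
    rintro _ rfl
    rw [Multiset.insert_eq_cons, Multiset.cons_add, Multiset.singleton_add]
    exact D.raise (Occ.rel_cons (le_max_left _ _) hle
      (Occ.rel_cons (le_max_right _ _) (by simp only [Nat.succ_eq_add_one] at *; omega)
        (hδ.rel_occs h₀.le)))
  | @andR n n₀ n₁ Γ Δ φ ψ i j h₀ h₁ d₀ d₁ ih₀ ih₁ =>
    have D₀ := ih₀ (σ := σ) (by omega)
    have D₁ := ih₁ (σ := σ) (by omega)
    rw [occs_cons_right] at D₀ D₁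
    rw [occs_cons_right]
    have e₁ := hδ.step h₀ (Nat.lt_succ_of_le (le_max_left φ.complexity ψ.complexity))
    have e₂ := hδ.step h₁ (Nat.lt_succ_of_le (le_max_right φ.complexity ψ.complexity))
    obtain ⟨e, he, hle⟩ := pred e₁
    rw [occ, Fml.complexity, he]
    refine .inv (n₀ := max n₀ n₁) (.andR ..) (max_lt h₀ h₁) ?_
    rintro _ (rfl | rfl)
    · exact (D₀.raise (Occ.rel_cons (le_max_left _ _) hle (hδ.rel_left h₀.le Γ Δ))).mono
        (le_max_left _ _)
    · exact (D₁.raise (Occ.rel_cons (le_max_right _ _)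
        (by simp only [Nat.succ_eq_add_one] at *; omega) (hδ.rel_right h₁.le Γ Δ))).mono
        (le_max_right _ _)
  | @allL n n₀ Γ Δ φ s i j h₀ d ih =>
    have D := ih (σ := σ) (by omega)
    rw [occs_cons_left, occs_cons_left, Multiset.cons_swap] at D
    rw [occs_cons_left]
    obtain ⟨e, he, hle⟩ := pred (hδ.step h₀ φ.complexity.lt_succ_self)
    have hmono := hδ.mono (φ.complexity + 1) h₀.le
    rw [occ, Fml.complexity, he]
    rw [Nat.succ_eq_add_one] at he
    refine .allL (s.subst σ) (Multiset.mem_cons_self _ _) h₀ ?_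
    rw [occ, Fml.subst_inst, Fml.complexity_inst] at D
    exact D.raise (Occ.rel_cons (le_max_right _ _) hle
      (Occ.rel_cons (le_max_left _ _) (he ▸ hmono) (hδ.rel_occs h₀.le)))
  | @allR n n₀ Γ Δ φ y i h₀ hΓ hΔ hφ d ih =>
    rw [occs_cons_right]
    obtain ⟨e, he, hle⟩ := pred (hδ.step h₀ φ.complexity.lt_succ_self)
    rw [occ, Fml.complexity, he]
    refine .inv (.allR ..) h₀ ?_
    rintro _ ⟨s, rfl⟩
    -- Redirecting the eigenvariable to `s` leaves the side formulas unchanged by freshness.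
    have D := ih (σ := Function.update σ y s) (by omega)
    rw [occs_cons_right, occs_update hΓ hΔ, occ, Fml.subst_inst, Fml.complexity_inst,
      Fml.subst_congr (τ := σ) φ, Tm.subst, Tm.lift_zero, Function.update_self] at D
    · exact D.raise (Occ.rel_cons le_rfl hle (hδ.rel_occs h₀.le))
    · intro x hx
      rw [Function.update_of_ne]
      rintro rfl
      exact hφ hx
  | eq1 Γ Δ t h₀ d ih =>
    have D := ih (σ := σ) (by omega)
    rw [occs_cons_left] at D
    exact D.arith_singleton (.eq1 _) (by simp) h₀ (hδ.rel_occs h₀.le)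
  | eq2 Γ Δ s t a b h₀ d ih =>
    have D := ih (σ := σ) (by omega)
    rw [occs_cons_left, occs_cons_left, Multiset.cons_swap, ← occs_cons_left, occ, Fml.subst,
      Tm.subst_inst, Tm.subst_inst] at D
    refine D.arith_singleton (.eq2 (s.subst σ) (t.subst σ) (a.subst σ) (b.subst σ)) ?_ h₀
      (hδ.rel_occs h₀.le)
    rw [occs_cons_left, occs_cons_left]
    rintro _ (rfl | rfl)
    · exact ⟨_, _, Multiset.mem_cons_self _ _⟩
    · rw [← Tm.subst_inst, ← Tm.subst_inst]
      exact ⟨_, _, Multiset.mem_cons_of_mem (Multiset.mem_cons_self _ _)⟩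
  | q1 n Γ Δ s =>
    rw [occs_cons_left]
    refine .arith (n₀ := 0) (.q1 (s.subst σ)) ?_ (by simp) (by simp)
    rintro _ rfl
    exact ⟨_, _, Multiset.mem_cons_self _ _⟩
  | q2 Γ Δ s t h₀ d ih =>
    have D := ih (σ := σ) (by omega)
    rw [occs_cons_left] at D
    refine D.arith_singleton (.q2 _ _) ?_ h₀ (hδ.rel_occs h₀.le)
    rw [occs_cons_left]
    rintro _ rfl
    exact ⟨_, _, Multiset.mem_cons_self _ _⟩
  | @q3 n n₀ n₁ Γ Δ s y h₀ h₁ hΓ hΔ hs d₀ d₁ ih₀ ih₁ =>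
    refine .arith (n₀ := max n₀ n₁) (.q3 (s.subst σ)) (by simp) (fun _ _ => max_lt h₀ h₁) ?_
    rintro _ (rfl | ⟨u, rfl⟩)
    · have D := ih₀ (σ := σ) (by omega)
      rw [occs_cons_left] at D
      exact (D.raise (Occ.rel_cons_eq (hδ.rel_left h₀.le Γ Δ))).mono (le_max_left _ _)
    · have D := ih₁ (σ := Function.update σ y u) (by omega)
      rw [occs_cons_left, occs_update (Ctx2.fresh_right hΓ) (Ctx2.fresh_right hΔ), occ, Fml.subst,
        Tm.subst_congr (τ := σ) s, Tm.subst, Tm.subst, Tm.lift_zero, Function.update_self] at D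
      · exact (D.raise (Occ.rel_cons_eq (hδ.rel_right h₁.le Γ Δ))).mono (le_max_right _ _)
      · intro x hx
        rw [Function.update_of_ne]
        rintro rfl
        exact hs hx
  | q4 Γ Δ s h₀ d ih =>
    have D := ih (σ := σ) (by omega)
    rw [occs_cons_left] at D
    exact D.arith_singleton (.q4 _) (by simp) h₀ (hδ.rel_occs h₀.le)
  | q5 Γ Δ s t h₀ d ih =>
    have D := ih (σ := σ) (by omega)
    rw [occs_cons_left] at D
    exact D.arith_singleton (.q5 _ _) (by simp) h₀ (hδ.rel_occs h₀.le)
  | q6 Γ Δ s h₀ d ih =>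
    have D := ih (σ := σ) (by omega)
    rw [occs_cons_left] at D
    exact D.arith_singleton (.q6 _) (by simp) h₀ (hδ.rel_occs h₀.le)
  | q7 Γ Δ s t h₀ d ih =>
    have D := ih (σ := σ) (by omega)
    rw [occs_cons_left] at D
    exact D.arith_singleton (.q7 _ _) (by simp) h₀ (hδ.rel_occs h₀.le)
  | trR Γ Δ φ i h₀ hφ hk d ih =>
    have D := ih (σ := σ) (by omega)
    rw [occs_cons_right, occ, hφ.subst_eq] at D
    rw [occs_cons_right, occ, subst_truthOf]
    -- The presence of a truth rule forces `1 ≤ k`.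
    obtain ⟨e, he, hle⟩ := pred (hδ.truth φ.complexity (by omega) h₀)
    rw [truthOf, Fml.complexity, he]
    refine .inv (.tr _ _ hφ _ _) h₀ ?_
    rintro _ rfl
    exact D.raise (Occ.rel_cons le_rfl hle (hδ.rel_occs h₀.le))
  | trL Γ Δ φ i h₀ hφ hk d ih =>
    have D := ih (σ := σ) (by omega)
    rw [occs_cons_left, occ, hφ.subst_eq] at D
    rw [occs_cons_left, occ, subst_truthOf]
    obtain ⟨e, he, hle⟩ := pred (hδ.truth φ.complexity (by omega) h₀)
    rw [truthOf, Fml.complexity, he]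
    refine .inv (.tr _ _ hφ _ _) h₀ ?_
    rintro _ rfl
    exact D.raise (Occ.rel_cons le_rfl hle (hδ.rel_occs h₀.le))

theorem Ctx2.join_tc_le {Γ : Ctx2} (h₀ : ∀ a ∈ Γ.left, a.2 ≤ k) (h₁ : ∀ a ∈ Γ.right, a.2 ≤ k) :
    ∀ a ∈ Γ.join, a.2 ≤ k := by
  rw [Ctx2.left, Multiset.forall_mem_map_iff] at h₀
  rw [Ctx2.right, Multiset.forall_mem_map_iff] at h₁
  rw [Ctx2.join, Multiset.forall_mem_map_iff]
  exact fun a ha => max_le (h₀ a ha) (h₁ a ha)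

theorem Der.tc_le (D : Der m k n Γ Δ) : (∀ a ∈ Γ, a.2 ≤ k) ∧ ∀ a ∈ Δ, a.2 ≤ k := by
  induction D <;> simp only [Multiset.forall_mem_cons, Multiset.forall_mem_map_iff] at *
  case cut ih₀ ih₁ =>
    exact ⟨Ctx2.join_tc_le ih₀.1 ih₁.1.2, Ctx2.join_tc_le ih₀.2.2 ih₁.2⟩
  case andR ih₀ ih₁ =>
    exact ⟨Ctx2.join_tc_le ih₀.1 ih₁.1, max_le ih₀.2.1 ih₁.2.1, Ctx2.join_tc_le ih₀.2.2 ih₁.2.2⟩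
  case q3 ih₀ ih₁ =>
    exact ⟨Ctx2.join_tc_le ih₀.1.2 ih₁.1.2, Ctx2.join_tc_le ih₀.2 ih₁.2⟩
  all_goals
    try simp only [max_le_iff, Nat.zero_le, implies_true, true_and] at *
  all_goals tauto

end

/-! ### Back to derivations with eigenvariables -/

/-- The formula `x` with its truth complexity respects the bounds of the occurrence `a`. -/
def Below (x : Fml 0 × ℕ) (a : Occ) : Prop :=
  x.1 = a.fml ∧ x.2 ≤ a.tc ∧ ∀ s t, x.1 = .eq s t → x.2 = 0

/-- The sequent `Γ ⇒ Δ` with its truth complexities respects the bounds of the signed sequent `G`. -/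
def Realizes (Γ Δ : Ctx) (G : Multiset Occ) : Prop :=
  Multiset.Rel Below Γ (G.filter fun a => a.side = true) ∧
    Multiset.Rel Below Δ (G.filter fun a => a.side = false)

/-- Some sequent that respects the bounds of `G` has a cut-free derivation of length at most `n`. -/
def Realizable (k n : ℕ) (G : Multiset Occ) : Prop :=
  ∃ Γ Δ : Ctx, Realizes Γ Δ G ∧ Der 0 k n Γ Δ

section

variable {k n n₀ : ℕ} {Γ Δ : Ctx} {G : Multiset Occ} {φ : Fml 0} {i d : ℕ}

theorem Realizes.cons_left {j : ℕ} (h : Realizes Γ Δ G) (hj : j ≤ i)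
    (he : ∀ s t, φ = .eq s t → j = 0) :
    Realizes ((φ, j) ::ₘ Γ) Δ (⟨true, φ, i, d⟩ ::ₘ G) := by
  refine ⟨?_, by simpa using h.2⟩
  rw [Multiset.filter_cons_of_pos (p := fun a : Occ => a.side = true) _ rfl]
  exact .cons ⟨rfl, hj, he⟩ h.1

theorem Realizes.cons_right {j : ℕ} (h : Realizes Γ Δ G) (hj : j ≤ i)
    (he : ∀ s t, φ = .eq s t → j = 0) :
    Realizes Γ ((φ, j) ::ₘ Δ) (⟨false, φ, i, d⟩ ::ₘ G) := by
  refine ⟨by simpa using h.1, ?_⟩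
  rw [Multiset.filter_cons_of_pos (p := fun a : Occ => a.side = false) _ rfl]
  exact .cons ⟨rfl, hj, he⟩ h.2

theorem Realizes.of_cons_left (h : Realizes Γ Δ (⟨true, φ, i, d⟩ ::ₘ G)) :
    ∃ j Γ', Γ = (φ, j) ::ₘ Γ' ∧ j ≤ i ∧ (∀ s t, φ = .eq s t → j = 0) ∧ Realizes Γ' Δ G := by
  obtain ⟨h₁, h₂⟩ := h
  rw [Multiset.filter_cons_of_pos (p := fun a : Occ => a.side = true) _ rfl] at h₁
  obtain ⟨⟨ψ, j⟩, Γ', ⟨hψ, hj, he⟩, h, rfl⟩ := Multiset.rel_cons_right.1 h₁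
  obtain rfl : ψ = φ := hψ
  exact ⟨j, Γ', rfl, hj, he, h, by simpa using h₂⟩

theorem Realizes.of_cons_right (h : Realizes Γ Δ (⟨false, φ, i, d⟩ ::ₘ G)) :
    ∃ j Δ', Δ = (φ, j) ::ₘ Δ' ∧ j ≤ i ∧ (∀ s t, φ = .eq s t → j = 0) ∧ Realizes Γ Δ' G := by
  obtain ⟨h₁, h₂⟩ := h
  rw [Multiset.filter_cons_of_pos (p := fun a : Occ => a.side = false) _ rfl] at h₂
  obtain ⟨⟨ψ, j⟩, Δ', ⟨hψ, hj, he⟩, h, rfl⟩ := Multiset.rel_cons_right.1 h₂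
  obtain rfl : ψ = φ := hψ
  exact ⟨j, Δ', rfl, hj, he, by simpa using h₁, h⟩

theorem Realizable.of_cons_left (h : Realizable k n (⟨true, φ, i, d⟩ ::ₘ G)) :
    ∃ j Γ Δ, j ≤ i ∧ (∀ s t, φ = .eq s t → j = 0) ∧ Realizes Γ Δ G ∧
      Der 0 k n ((φ, j) ::ₘ Γ) Δ := by
  obtain ⟨Γ, Δ, h, D⟩ := h
  obtain ⟨j, Γ, rfl, hj, he, h⟩ := h.of_cons_left
  exact ⟨j, Γ, Δ, hj, he, h, D⟩

theorem Realizable.of_cons_right (h : Realizable k n (⟨false, φ, i, d⟩ ::ₘ G)) :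
    ∃ j Γ Δ, j ≤ i ∧ (∀ s t, φ = .eq s t → j = 0) ∧ Realizes Γ Δ G ∧
      Der 0 k n Γ ((φ, j) ::ₘ Δ) := by
  obtain ⟨Γ, Δ, h, D⟩ := h
  obtain ⟨j, Δ, rfl, hj, he, h⟩ := h.of_cons_right
  exact ⟨j, Γ, Δ, hj, he, h, D⟩

theorem Realizable.of_cons_eq {s t : Tm 0} (h : Realizable k n (⟨true, .eq s t, i, d⟩ ::ₘ G)) :
    ∃ Γ Δ, Realizes Γ Δ G ∧ Der 0 k n ((.eq s t, 0) ::ₘ Γ) Δ := by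
  obtain ⟨j, Γ, Δ, -, he, h, D⟩ := h.of_cons_left
  obtain rfl := he s t rfl
  exact ⟨Γ, Δ, h, D⟩

theorem Realizes.of_cons_eq {s t : Tm 0} (h : Realizes Γ Δ (⟨true, .eq s t, i, d⟩ ::ₘ G)) :
    ∃ Γ', Γ = (.eq s t, 0) ::ₘ Γ' ∧ Realizes Γ' Δ G := by
  obtain ⟨j, Γ', rfl, -, he, h'⟩ := h.of_cons_left
  obtain rfl := he s t rfl
  exact ⟨Γ', rfl, h'⟩

/-- The premisses of a two-premiss rule are realized independently. Matching both with the same `G`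
pairs their occurrences, and the maximum still respects the bounds. -/
theorem Below.exists_join {Γ Δ : Ctx} {G : Multiset Occ} (h₁ : Multiset.Rel Below Γ G)
    (h₂ : Multiset.Rel Below Δ G) :
    ∃ K : Ctx2, K.left = Γ ∧ K.right = Δ ∧ Multiset.Rel Below K.join G := by
  induction G using Multiset.induction generalizing Γ Δ with
  | empty =>
    obtain rfl := Multiset.rel_zero_right.1 h₁
    obtain rfl := Multiset.rel_zero_right.1 h₂
    exact ⟨0, rfl, rfl, .zero⟩
  | cons a G ih =>
    obtain ⟨⟨φ, i⟩, Γ, ⟨hφ, hi, hi'⟩, h₁', rfl⟩ := Multiset.rel_cons_right.1 h₁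
    obtain ⟨⟨ψ, j⟩, Δ, ⟨hψ, hj, hj'⟩, h₂', rfl⟩ := Multiset.rel_cons_right.1 h₂
    obtain rfl : φ = ψ := hφ.trans hψ.symm
    obtain ⟨K, rfl, rfl, hK⟩ := ih h₁' h₂'
    refine ⟨(φ, i, j) ::ₘ K, by simp [Ctx2.left], by simp [Ctx2.right], ?_⟩
    rw [Ctx2.join, Multiset.map_cons]
    exact .cons ⟨hφ, max_le hi hj, fun s t h =>
      Nat.max_eq_zero_iff.2 ⟨hi' s t h, hj' s t h⟩⟩ hK

theorem Realizes.exists_join {Γ₀ Δ₀ Γ₁ Δ₁ : Ctx} (h₀ : Realizes Γ₀ Δ₀ G)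
    (h₁ : Realizes Γ₁ Δ₁ G) :
    ∃ Γ Δ : Ctx2, Γ.left = Γ₀ ∧ Γ.right = Γ₁ ∧ Δ.left = Δ₀ ∧ Δ.right = Δ₁ ∧
      Realizes Γ.join Δ.join G := by
  obtain ⟨Γ, hΓ₀, hΓ₁, hΓ⟩ := Below.exists_join h₀.1 h₁.1
  obtain ⟨Δ, hΔ₀, hΔ₁, hΔ⟩ := Below.exists_join h₀.2 h₁.2
  exact ⟨Γ, Δ, hΓ₀, hΓ₁, hΔ₀, hΔ₁, hΓ, hΔ⟩

theorem realizes_zero (G : Multiset Occ) :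
    ∃ Γ Δ : Multiset (Fml 0), Realizes (Γ.map fun φ => (φ, 0)) (Δ.map fun φ => (φ, 0)) G := by
  refine ⟨(G.filter fun a => a.side = true).map Occ.fml,
    (G.filter fun a => a.side = false).map Occ.fml, ?_, ?_⟩ <;>
  · rw [Multiset.map_map, Multiset.rel_map_left]
    exact Multiset.rel_refl_of_refl_on fun a _ => ⟨rfl, Nat.zero_le _, fun _ _ _ => rfl⟩

theorem Realizes.exists_fml_eq {a : Fml 0 × ℕ} (h : Realizes Γ Δ G) (ha : a ∈ Γ ∨ a ∈ Δ) :
    ∃ b ∈ G, a.1 = b.fml := by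
  rcases ha with ha | ha
  · obtain ⟨b, hb, hab⟩ := Multiset.exists_mem_of_rel_of_mem h.1 ha
    exact ⟨b, Multiset.mem_of_mem_filter hb, hab.1⟩
  · obtain ⟨b, hb, hab⟩ := Multiset.exists_mem_of_rel_of_mem h.2 ha
    exact ⟨b, Multiset.mem_of_mem_filter hb, hab.1⟩

/-- The variable must be fixed before the premiss is realized; this is possible because every
realization of `G` has the same formulas as `G`. -/
theorem exists_fresh (G : Multiset Occ) (F : Finset ℕ) :
    ∃ y, y ∉ F ∧ ∀ Γ Δ : Ctx, Realizes Γ Δ G → Γ.Fresh y ∧ Δ.Fresh y := by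
  classical
  obtain ⟨y, hy⟩ := Infinite.exists_notMem_finset (F ∪ (G.toFinset.biUnion fun a => a.fml.FV))
  simp only [Finset.mem_union, Finset.mem_biUnion, Multiset.mem_toFinset, not_or, not_exists,
    not_and] at hy
  refine ⟨y, hy.1, fun Γ Δ h => ⟨fun a ha => ?_, fun a ha => ?_⟩⟩
  · obtain ⟨b, hb, hab⟩ := h.exists_fml_eq (.inl ha)
    exact hab ▸ hy.2 b hb
  · obtain ⟨b, hb, hab⟩ := h.exists_fml_eq (.inr ha)
    exact hab ▸ hy.2 b hb

theorem Realizable.eq2 {s t : Tm 0} {a b : Tm 1} {i₁ d₁ i₂ d₂ i₃ d₃ : ℕ} (h₀ : n₀ < n)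
    (h : Realizable k n₀ (⟨true, .eq (Tm.inst s a) (Tm.inst s b), i₁, d₁⟩ ::ₘ
      ⟨true, .eq s t, i₂, d₂⟩ ::ₘ ⟨true, .eq (Tm.inst t a) (Tm.inst t b), i₃, d₃⟩ ::ₘ G)) :
    Realizable k n (⟨true, .eq s t, i₂, d₂⟩ ::ₘ
      ⟨true, .eq (Tm.inst t a) (Tm.inst t b), i₃, d₃⟩ ::ₘ G) := by
  obtain ⟨Γ, Δ, h, D⟩ := h.of_cons_eq
  obtain ⟨Γ, rfl, h'⟩ := h.of_cons_eq
  obtain ⟨Γ, rfl, h''⟩ := h'.of_cons_eq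
  rw [Multiset.cons_swap] at D
  exact ⟨_, _, (h''.cons_left (Nat.zero_le _) (by simp)).cons_left (Nat.zero_le _) (by simp),
    .eq2 _ _ _ _ _ _ h₀ D⟩

theorem Realizable.eq1 {t : Tm 0} (h₀ : n₀ < n)
    (h : Realizable k n₀ (⟨true, .eq t t, i, d⟩ ::ₘ G)) : Realizable k n G := by
  obtain ⟨Γ, Δ, h, D⟩ := h.of_cons_eq
  exact ⟨_, _, h, .eq1 _ _ _ h₀ D⟩

/-- A second copy of an equation in the antecedent can be removed at the cost of two inferences. -/
theorem Realizable.contract_eq {s t : Tm 0} {i' d' n' : ℕ} (hn : n + 2 ≤ n')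
    (h : Realizable k n (⟨true, .eq s t, i', d'⟩ ::ₘ ⟨true, .eq s t, i, d⟩ ::ₘ
      ⟨true, .eq t t, 0, 0⟩ ::ₘ G)) :
    Realizable k n' (⟨true, .eq s t, i, d⟩ ::ₘ G) := by
  have key : Realizable k (n + 1) (⟨true, .eq s t, i, d⟩ ::ₘ ⟨true, .eq t t, 0, 0⟩ ::ₘ G) := by
    -- Replacement in `v = t`: the extra copy of `s = t` plays `φ(s)` and `t = t` plays `φ(t)`; the
    -- latter is then removed by reflexivity.
    have := @Realizable.eq2 k (n + 1) n G s t (.bv 0) (Tm.lift t) i' d' i d 0 0 n.lt_succ_self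
    rw [Tm.inst_lift, Tm.inst_lift, Tm.lift_zero] at this
    simp only [Tm.inst, Fin.cases_zero, Tm.lift_zero] at this
    exact this h
  rw [Multiset.cons_swap] at key
  exact key.eq1 (by omega)

end

/-- With `r = 0` there is no cut, so every occurrence in a premiss inherits a bound at most `k`, and
the side condition of the truth rules holds. -/
theorem Deriv.realizable {k n : ℕ} {G : Multiset Occ} (D : Deriv 0 n G) (hk : ∀ a ∈ G, a.tc ≤ k) :
    Realizable k (3 * n) G := by
  induction n using Nat.strong_induction_on generalizing G with
  | _ n ih =>
  have hk' : ∀ {b φ i d}, i ≤ k → ∀ a ∈ (⟨b, φ, i, d⟩ ::ₘ G : Multiset Occ), a.tc ≤ k := by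
    intro b φ i d h a ha
    rcases Multiset.mem_cons.1 ha with rfl | ha
    exacts [h, hk a ha]
  cases D with
  | ref hL hR =>
    obtain ⟨G, rfl⟩ := Multiset.exists_cons_of_mem hL
    obtain ⟨G, rfl⟩ := Multiset.exists_cons_of_mem ((Multiset.mem_cons.1 hR).resolve_left (by simp))
    obtain ⟨Γ, Δ, h⟩ := realizes_zero G
    exact ⟨_, _, (h.cons_right (Nat.zero_le _) (by simp)).cons_left (Nat.zero_le _) (by simp),
      .ref ..⟩
  | @arith _ n₀ _ P J hPJ hP h₀ D =>
    have ih' : ∀ e ∈ J, 3 * n₀ < 3 * n ∧ Realizable k (3 * n₀) (⟨true, e, 0, 0⟩ ::ₘ G) :=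
      fun e he => ⟨by have := h₀ e he; omega, ih n₀ (h₀ e he) (D e he) (hk' (Nat.zero_le _))⟩
    cases hPJ with
    | eq1 t =>
      obtain ⟨h₀, h⟩ := ih' _ rfl
      exact h.eq1 h₀
    | eq2 s t a b =>
      obtain ⟨i₁, d₁, h₁⟩ := hP _ (.inl rfl)
      obtain ⟨i₂, d₂, h₂⟩ := hP _ (.inr rfl)
      obtain ⟨G, rfl⟩ := Multiset.exists_cons_of_mem h₁
      -- Membership lets one occurrence serve as both principal equations, whereas `Der.eq2` needs
      -- two. In that case a second copy and `t = t` are added by weakening, and `contract_eq`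
      -- removes them: three inferences for one.
      rcases Multiset.mem_cons.1 h₂ with h | h
      · have h₀ := h₀ _ rfl
        simp only [Occ.mk.injEq, true_and] at h
        obtain ⟨h, rfl, rfl⟩ := h
        have E := ih n₀ h₀ (((D _ rfl).weaken_cons ⟨true, .eq s t, i₂, d₂⟩).weaken_cons
            ⟨true, .eq t t, 0, 0⟩) (by
          simp only [Multiset.mem_cons, forall_eq_or_imp] at hk ⊢
          exact ⟨Nat.zero_le _, hk.1, Nat.zero_le _, hk⟩)
        have E' : Realizable k (3 * n₀ + 1) (⟨true, .eq s t, i₂, d₂⟩ ::ₘ ⟨true, .eq s t, i₂, d₂⟩ ::ₘ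
            ⟨true, .eq t t, 0, 0⟩ ::ₘ G) := by
          have := @Realizable.eq2 k (3 * n₀ + 1) (3 * n₀) (⟨true, .eq t t, 0, 0⟩ ::ₘ G) s t a b
            0 0 i₂ d₂ i₂ d₂ (by omega)
          rw [h] at this
          refine this ?_
          convert E using 1
          simp only [← Multiset.singleton_add]
          abel
        exact E'.contract_eq (by omega)
      · obtain ⟨G, rfl⟩ := Multiset.exists_cons_of_mem h
        obtain ⟨h₀, h⟩ := ih' _ rfl
        exact h.eq2 h₀
    | q1 s =>
      obtain ⟨i, d, h⟩ := hP _ rfl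
      obtain ⟨G, rfl⟩ := Multiset.exists_cons_of_mem h
      obtain ⟨Γ, Δ, h⟩ := realizes_zero G
      exact ⟨_, _, h.cons_left (Nat.zero_le _) (by simp), .q1 ..⟩
    | q2 s t =>
      obtain ⟨i, d, h⟩ := hP _ rfl
      obtain ⟨G, rfl⟩ := Multiset.exists_cons_of_mem h
      obtain ⟨h₀, h⟩ := ih' _ rfl
      obtain ⟨Γ, Δ, h, D⟩ := h.of_cons_eq
      obtain ⟨Γ, rfl, h'⟩ := h.of_cons_eq
      exact ⟨_, _, h'.cons_left (Nat.zero_le _) (by simp), .q2 _ _ _ _ h₀ D⟩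
    | q3 s =>
      obtain ⟨y, hy, hfresh⟩ := exists_fresh G s.FV
      obtain ⟨h₀, h₁⟩ := ih' _ (.inl rfl)
      obtain ⟨-, h₂⟩ := ih' _ (.inr ⟨.fv y, rfl⟩)
      obtain ⟨Γ₁, Δ₁, h₁, D₁⟩ := h₁.of_cons_eq
      obtain ⟨Γ₂, Δ₂, h₂, D₂⟩ := h₂.of_cons_eq
      obtain ⟨Γ, Δ, rfl, rfl, rfl, rfl, h⟩ := h₁.exists_join h₂
      exact ⟨_, _, h, .q3 _ _ _ y h₀ h₀ (hfresh _ _ h).1 (hfresh _ _ h).2 hy D₁ D₂⟩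
    | q4 s =>
      obtain ⟨h₀, h⟩ := ih' _ rfl
      obtain ⟨Γ, Δ, h, D⟩ := h.of_cons_eq
      exact ⟨_, _, h, .q4 _ _ _ h₀ D⟩
    | q5 s t =>
      obtain ⟨h₀, h⟩ := ih' _ rfl
      obtain ⟨Γ, Δ, h, D⟩ := h.of_cons_eq
      exact ⟨_, _, h, .q5 _ _ _ _ h₀ D⟩
    | q6 s =>
      obtain ⟨h₀, h⟩ := ih' _ rfl
      obtain ⟨Γ, Δ, h, D⟩ := h.of_cons_eq
      exact ⟨_, _, h, .q6 _ _ _ h₀ D⟩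
    | q7 s t =>
      obtain ⟨h₀, h⟩ := ih' _ rfl
      obtain ⟨Γ, Δ, h, D⟩ := h.of_cons_eq
      exact ⟨_, _, h, .q7 _ _ _ _ h₀ D⟩
  | @allL _ n₀ _ φ i d s hG h₀ D =>
    have h := ih n₀ h₀ D (hk' (hk _ hG))
    obtain ⟨G, rfl⟩ := Multiset.exists_cons_of_mem hG
    obtain ⟨j, Γ, Δ, hj, -, h, D⟩ := h.of_cons_left
    obtain ⟨j', Γ, rfl, hj', -, h⟩ := h.of_cons_left
    rw [Multiset.cons_swap] at D
    exact ⟨_, _, h.cons_left (max_le hj' hj) (by simp), .allL _ _ _ s _ _ (by omega) D⟩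
  | @inv _ n₀ G a J ha h₀ D =>
    have h₀' : 3 * n₀ < 3 * n := by omega
    simp only [Multiset.mem_cons, forall_eq_or_imp] at hk
    obtain ⟨ha', hk⟩ := hk
    have hk₁ : ∀ {b φ i d}, i ≤ k → ∀ a ∈ (⟨b, φ, i, d⟩ ::ₘ G : Multiset Occ), a.tc ≤ k := by
      intro b φ i d h a ha
      rcases Multiset.mem_cons.1 ha with rfl | ha
      exacts [h, hk a ha]
    cases ha with
    | neg b φ i d =>
      have h := ih n₀ h₀ (D _ rfl) (hk₁ ha')
      cases b with
      | true =>
        obtain ⟨j, Γ, Δ, hj, -, h, D⟩ := h.of_cons_right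
        exact ⟨_, _, h.cons_left hj (by simp), .negL _ _ _ _ h₀' D⟩
      | false =>
        obtain ⟨j, Γ, Δ, hj, -, h, D⟩ := h.of_cons_left
        exact ⟨_, _, h.cons_right hj (by simp), .negR _ _ _ _ h₀' D⟩
    | andL φ ψ i d =>
      have D := D _ rfl
      rw [Multiset.insert_eq_cons, Multiset.cons_add, Multiset.singleton_add] at D
      have h := ih n₀ h₀ D (by
        simp only [Multiset.mem_cons, forall_eq_or_imp]
        exact ⟨ha', ha', hk⟩)
      obtain ⟨j, Γ, Δ, hj, -, h, D⟩ := h.of_cons_left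
      obtain ⟨j', Γ, rfl, hj', -, h⟩ := h.of_cons_left
      exact ⟨_, _, h.cons_left (max_le hj hj') (by simp), .andL _ _ _ _ _ _ h₀' D⟩
    | andR φ ψ i d =>
      have h₁ := ih n₀ h₀ (D _ (.inl rfl)) (hk₁ ha')
      have h₂ := ih n₀ h₀ (D _ (.inr rfl)) (hk₁ ha')
      obtain ⟨j₁, Γ₁, Δ₁, hj₁, -, h₁, D₁⟩ := h₁.of_cons_right
      obtain ⟨j₂, Γ₂, Δ₂, hj₂, -, h₂, D₂⟩ := h₂.of_cons_right
      obtain ⟨Γ, Δ, rfl, rfl, rfl, rfl, h⟩ := h₁.exists_join h₂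
      exact ⟨_, _, h.cons_right (max_le hj₁ hj₂) (by simp), .andR _ _ _ _ _ _ h₀' h₀' D₁ D₂⟩
    | allR φ i d =>
      obtain ⟨y, hy, hfresh⟩ := exists_fresh G φ.FV
      -- Of all instances only the one at a fresh variable is kept.
      have h := ih n₀ h₀ (D _ ⟨.fv y, rfl⟩) (hk₁ ha')
      obtain ⟨j, Γ, Δ, hj, -, h, D⟩ := h.of_cons_right
      exact ⟨_, _, h.cons_right hj (by simp),
        .allR _ _ _ y _ h₀' (hfresh _ _ h).1 (hfresh _ _ h).2 hy D⟩
    | tr b φ hφ i d =>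
      have h := ih n₀ h₀ (D _ rfl) (hk₁ (Nat.le_of_succ_le ha'))
      cases b with
      | true =>
        obtain ⟨j, Γ, Δ, hj, -, h, D⟩ := h.of_cons_left
        exact ⟨_, _, h.cons_left (Nat.succ_le_succ hj) (by simp [truthOf]),
          .trL _ _ _ _ h₀' hφ ((Nat.succ_le_succ hj).trans ha') D⟩
      | false =>
        obtain ⟨j, Γ, Δ, hj, -, h, D⟩ := h.of_cons_right
        exact ⟨_, _, h.cons_right (Nat.succ_le_succ hj) (by simp [truthOf]),
          .trR _ _ _ _ h₀' hφ ((Nat.succ_le_succ hj).trans ha') D⟩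
  | cut h₀ h₁ hd D₀ D₁ => omega

/-! ### Assembling the bounds -/

theorem Below.map_fst {Γ : Ctx} {G : Multiset Occ} (h : Multiset.Rel Below Γ G) :
    Γ.forget = G.map Occ.fml := by
  rw [Ctx.forget, ← Multiset.rel_eq, Multiset.rel_map]
  exact h.mono fun a _ b _ hab => hab.1

theorem filter_occs (δ : ℕ → ℕ → ℕ) (n : ℕ) (Γ Δ : Ctx) :
    ((occs δ Tm.fv n Γ Δ).filter fun a => a.side = true).map Occ.fml = Γ.forget ∧
      ((occs δ Tm.fv n Γ Δ).filter fun a => a.side = false).map Occ.fml = Δ.forget := by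
  constructor <;>
    simp [occs, occ, Multiset.filter_add, Multiset.filter_map, Multiset.map_map, Ctx.forget,
      Fml.subst_fv]

theorem DepthBound.provable {m k n r : ℕ} {δ : ℕ → ℕ → ℕ} {Γ Δ : Multiset (Fml 0)}
    (hδ : DepthBound m k n r δ) (h : Provable n m k Γ Δ) :
    Provable (3 * hyperexp n r) 0 k Γ Δ := by
  obtain ⟨Γ, Δ, rfl, rfl, D⟩ := h
  have hk : ∀ a ∈ occs δ Tm.fv n Γ Δ, a.tc ≤ k := by
    have h := D.tc_le
    intro a ha
    rw [occs, Multiset.mem_add, Multiset.mem_map, Multiset.mem_map] at ha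
    rcases ha with ⟨x, hx, rfl⟩ | ⟨x, hx, rfl⟩
    exacts [h.1 x hx, h.2 x hx]
  obtain ⟨Γ', Δ', h, E⟩ := (D.toDeriv hδ le_rfl).cut_elimination.realizable hk
  exact ⟨Γ', Δ', (Below.map_fst h.1).trans (filter_occs δ n Γ Δ).1,
    (Below.map_fst h.2).trans (filter_occs δ n Γ Δ).2, E⟩

end LPTN

theorem mainTheorem2 :
    ∃ C : ℕ, ∀ (n m k : ℕ) (Γ Δ : Multiset (LPTN.Fml 0)), LPTN.Provable n m k Γ Δ →
      LPTN.Provable (C * LPTN.hyperexp n n) 0 k Γ Δ ∧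
      (k = 0 → LPTN.Provable (C * LPTN.hyperexp n m) 0 k Γ Δ) := by
  refine ⟨3, fun n m k Γ Δ h => ⟨(LPTN.DepthBound.length m k n).provable h, ?_⟩⟩
  rintro rfl
  exact (LPTN.DepthBound.complexity m n).provable h
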